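/- **Theorem (robust asymptotic stability in expectation of the closed loop).** *System.* Let $m,p,\tau,L\ge 1$ and consider $y_k=\Phi\xi_k+\Psi u_k+d_k$ with $u_k\in\mathbb R^m$, $y_k,d_k\in\mathbb R^p$ and the extended state $\xi_k=\mathrm{col}(u_{k-\tau},\dots,u_{k-1},y_{k-\tau},\dots,y_{k-1})\in\mathbb R^{n_\xi}$, $n_\xi=(m+p)\tau$; equivalently $\xi_{k+1}=\tilde A\xi_k+\tilde Bu_k+\tilde Ed_k$, where $\tilde A=\mathrm{col}(\bar A,\Phi)$, $\tilde B=\mathrm{col}(\bar B,\Psi)$, $\tilde E=\mathrm{col}(0,I_p)$, and $\bar A,\bar B$ shift the stored inputs and outputs and store $u_k$. The disturbances $d_k$ are i.i.d. with zero mean and a distribution $\mu$ supported in a compact polytope $\mathbb D=\{d: G_dd\le g_d\}\ni 0$; $\Sigma=\mathbb E[dd^\top]$. *Data and parameter polytope.* An input-output trajectory of the system on times $1-\tau,\dots,T$ is recorded, whose unknown disturbances $d^{\rm d}_1,\dots,d^{\rm d}_T$ lie in $\mathbb D$; let $H_\xi,H_u,H_y$ have the recorded extended states, inputs and outputs at times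 $1,\dots,T$ as columns, let $S=\mathrm{col}(H_\xi,H_u)$ have full row rank, and put $S^\dagger=S^\top(SS^\top)^{-1}$. The matrices $[\Phi_j\ \Psi_j]$, $j=1,\dots,N_v$, are such that their convex hull contains all $(H_y-H_d)S^\dagger$ for which $H_d\in\mathbb R^{p\times T}$ has columns in $\mathbb D$ and $(H_y-H_d)(I-S^\dagger S)=0$ (if prior knowledge $G_1[\Phi\ \Psi]G_2\le G_3$ on the true system is available, only those that satisfy it). With $\tilde A_j=\mathrm{col}(\bar A,\Phi_j)$, $\tilde B_j=\mathrm{col}(\bar B,\Psi_j)$ let $\tilde{\mathbb A}=\mathrm{conv}\{[\tilde A_j\ \tilde B_j]\}_j$. *Controller.* Let $Q,R,P\succ0$, let $K$ be a gain, $\tilde A_{\rm cl}=\tilde A+\tilde BK$, $\tilde A_{{\rm cl},j}=\tilde A_j+\tilde B_jK$, and assume for all $j$ $$\tilde A_{{\rm cl},j}^\top P\tilde A_{{\rm cl},j}-P+K^\top RK+\tilde A_{{\rm cl},j}^\top\tilde EQ\tilde E^\top\tilde A_{{\rm cl},j}\prec0 .$$ For $v=(v_0,\dots,v_{L-1})\in(\mathbb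 R^m)^L$ let $J(\xi,v)=\mathbb E\big[\sum_{l=0}^{L-1}(\|y_l\|_Q^2+\|u_l\|_R^2)+\|\xi_L\|_P^2\big]$ be the expected cost of the trajectory that starts in $\xi$ under $u_l=K\xi_l+v_l$. Let $\mathbb C$ be a polyhedron of pairs $(\xi,v)$ and let $\mathbb X=\{\xi: G\xi\le g\}$ be a polyhedron with $0$ in its interior that is robust control invariant: for each $\xi\in\mathbb X$ there is $v_0$ such that $(\xi,v_0,v_1,\dots,v_{L-1})\in\mathbb C$ for some $v_1,\dots,v_{L-1}$ and $\tilde A_{{\rm cl},j}\xi+\tilde B_jv_0+\tilde Ed\in\mathbb X$ for all $d\in\mathbb D$ and all $j$. Let $\mathbb F(\xi)$ be the set of all $v$ with $(\xi,v)\in\mathbb C$ and $\tilde A_{{\rm cl},j}\xi+\tilde B_jv_0+\tilde Ed\in\mathbb X$ for all $d\in\mathbb D$ and all $j$. Let $v^*(\xi)$ minimize $J(\xi,\cdot)$ over $\mathbb F(\xi)$ for $\xi\in\mathbb X$, let $J^*(\xi)$ be the minimum, and let $\kappa(\xi)=K\xi+v_0^*(\xi)$. Assume that there are $P_l\succeq0$,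 $P_u\succ0$ and $c\in\mathbb R$ with $\|\xi\|_{P_l}^2\le J^*(\xi)-c\le\|\xi\|_{P_u}^2$ for all $\xi\in\mathbb X$. *IOSS constants.* Let $P_W\succ0$ and $c_u,c_y,c_d>0$ be such that $W(\xi)=\|\xi\|_{P_W}^2$ satisfies, for all $\xi,u,d$ and $y=\Phi\xi+\Psi u+d$, $$W(\tilde A\xi+\tilde Bu+\tilde Ed)-W(\xi)\le-\tfrac12\|\xi\|^2+c_u\|u\|^2+c_y\|y\|^2+c_d\|d\|^2 .$$ *Claim.* Let $\varepsilon_{\rm f}\in[0,1)$ be such that for every $\xi\in\mathbb X$ the candidate $\tilde v_l=v^*_{l+1}(\xi)+K\tilde A_{\rm cl}^l\tilde Ed$, $0\le l\le L-1$, with $v^*_L:=0$, fails to lie in $\mathbb F(\tilde A\xi+\tilde B\kappa(\xi)+\tilde Ed)$ with probability at most $\varepsilon_{\rm f}$ for $d\sim\mu$. Put $c_S=\min(\lambda_{\min}(Q),\lambda_{\min}(R))/\max(c_u,c_y)$ and suppose that $$Q_S=\begin{bmatrix}\frac{c_S}2I&0\\0&R-c_Sc_uI\end{bmatrix}-\frac{\varepsilon_{\rm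 f}}{1-\varepsilon_{\rm f}}\begin{bmatrix}A^\top P_uA-P_l&A^\top P_uB\\B^\top P_uA&B^\top P_uB\end{bmatrix}\succ0\quad\text{for all }[A\ B]\in\tilde{\mathbb A}.$$ Then the origin of $\xi_{k+1}=\tilde A\xi_k+\tilde B\kappa(\xi_k)+\tilde Ed_k$ is robustly asymptotically stable in expectation on $\mathbb X$: $\mathbb X$ is closed and robust positive invariant for $d_k\in\mathbb D$, and there are $\beta$ of class $\mathcal{KL}$ and $\rho$ of class $\mathcal K$ such that $$\mathbb E\|\xi_k\|\le\beta(\|\xi_0\|,k)+\rho(\operatorname{tr}\Sigma)\qquad\text{for all }k\ge0,\ \xi_0\in\mathbb X .$$ The functions $\beta,\rho$ can be chosen independently of the disturbance distribution: for the same controller they serve every zero-mean distribution supported in $\mathbb D$ under which the candidate is infeasible with probability at most $\varepsilon_{\rm f}$ from every $\xi\in\mathbb X$. (Here $\beta(r,\cdot)$ is continuous and strictly decreasing to $0$ for each $r>0$, and $\beta(\cdot,t)$ is of class $\mathcal K$ for each $t\ge0$.) -/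

import Mathlib

open MeasureTheory Filter Topology

noncomputable section

/-! ### Comparison functions -/

/-- Class `K` on `[0, ∞)`: continuous, strictly increasing, zero at zero. -/
def IsClassK (ρ : ℝ → ℝ) : Prop :=
  ContinuousOn ρ (Set.Ici 0) ∧ StrictMonoOn ρ (Set.Ici 0) ∧ ρ 0 = 0

/-- Class `KL` on `[0, ∞) × [0, ∞)`. For `r = 0` the function `β 0 ·` vanishes on `[0, ∞)` by the
first clause, so that strict decrease is only meaningful (and required) for `r > 0`. -/
def IsClassKL (β : ℝ → ℝ → ℝ) : Prop :=
  (∀ t, 0 ≤ t → IsClassK fun r => β r t) ∧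
  ∀ r, 0 < r → ContinuousOn (β r) (Set.Ici 0) ∧ StrictAntiOn (β r) (Set.Ici 0) ∧
    Tendsto (β r) atTop (𝓝 0)

/-! ### Linear algebra -/

/-- The Euclidean norm of a coordinate vector. -/
def euclNorm {ι : Type*} [Fintype ι] (x : ι → ℝ) : ℝ :=
  ‖(WithLp.toLp 2 x : EuclideanSpace ℝ ι)‖

/-- The weighted square `‖x‖²_M = xᵀ M x`. -/
def wsq {ι : Type*} [Fintype ι] (M : Matrix ι ι ℝ) (x : ι → ℝ) : ℝ := x ⬝ᵥ M.mulVec x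

/-- The smallest eigenvalue of a real symmetric matrix (of positive size). -/
def evMin {ι : Type*} [Fintype ι] [DecidableEq ι] (M : Matrix ι ι ℝ) : ℝ := sInf (spectrum ℝ M)

/-- The polyhedron `{x | G x ≤ g}` (componentwise inequality). -/
def polyhedron {κ ι : Type*} [Fintype ι] (G : Matrix κ ι ℝ) (g : κ → ℝ) : Set (ι → ℝ) :=
  {x | G.mulVec x ≤ g}

/-! ### The extended state and its dynamics -/

/-- Coordinates of the extended state: `τ` past inputs in `ℝ^m`, then `τ` past outputs in `ℝ^p`,
the oldest ones first. -/
abbrev XiIdx (m p τ : ℕ) : Type := (Fin τ × Fin m) ⊕ (Fin τ × Fin p)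

/-- The extended state at time `k`, `col(u_{k-τ}, …, u_{k-1}, y_{k-τ}, …, y_{k-1})`. -/
def extState {m p : ℕ} (τ : ℕ) (u : ℤ → Fin m → ℝ) (y : ℤ → Fin p → ℝ) (k : ℤ) :
    XiIdx m p τ → ℝ
  | Sum.inl (i, a) => u (k - τ + (i : ℕ)) a
  | Sum.inr (i, b) => y (k - τ + (i : ℕ)) b

/-- `Ã = col(Ā, Φ)`: shift of the past inputs and outputs, with `Φ` in the newest output block. -/
def Atilde {m p τ : ℕ} (Φ : Matrix (Fin p) (XiIdx m p τ) ℝ) :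
    Matrix (XiIdx m p τ) (XiIdx m p τ) ℝ := fun r c =>
  match r with
  | Sum.inl (i, a) =>
      match c with
      | Sum.inl (j, b) => if (j : ℕ) = i + 1 ∧ b = a then 1 else 0
      | Sum.inr _ => 0
  | Sum.inr (i, a) =>
      if (i : ℕ) + 1 = τ then Φ a c
      else
        match c with
        | Sum.inl _ => 0
        | Sum.inr (j, b) => if (j : ℕ) = i + 1 ∧ b = a then 1 else 0

/-- `B̃ = col(B̄, Ψ)`: the identity in the newest input block, `Ψ` in the newest output block. -/
def Btilde {m p τ : ℕ} (Ψ : Matrix (Fin p) (Fin m) ℝ) : Matrix (XiIdx m p τ) (Fin m) ℝ :=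
  fun r b =>
    match r with
    | Sum.inl (i, a) => if (i : ℕ) + 1 = τ ∧ b = a then 1 else 0
    | Sum.inr (i, a) => if (i : ℕ) + 1 = τ then Ψ a b else 0

/-- `Ẽ = col(0, I_p)`: the identity in the newest output block. -/
def Etilde {m p τ : ℕ} : Matrix (XiIdx m p τ) (Fin p) ℝ := fun r b =>
  match r with
  | Sum.inl _ => 0
  | Sum.inr (i, a) => if (i : ℕ) + 1 = τ ∧ b = a then 1 else 0

/-! ### System parameters consistent with recorded data

The recorded inputs `ud` and outputs `yd` are used at the times `1 - τ, …, T`; column `i : Fin T` of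
a data matrix belongs to time `i + 1`. -/

/-- The data matrix `S`, extended states on top of inputs. -/
def dataS {m p : ℕ} (τ T : ℕ) (ud : ℤ → Fin m → ℝ) (yd : ℤ → Fin p → ℝ) :
    Matrix (XiIdx m p τ ⊕ Fin m) (Fin T) ℝ :=
  Matrix.fromRows (Matrix.of fun r i => extState τ ud yd ((i : ℕ) + 1) r)
    (Matrix.of fun a i => ud ((i : ℕ) + 1) a)

/-- The right inverse `S† = Sᵀ (S Sᵀ)⁻¹` of a matrix of full row rank. -/
def rightInv {ι κ : Type*} [Fintype ι] [DecidableEq ι] [Fintype κ] (S : Matrix ι κ ℝ) :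
    Matrix κ ι ℝ :=
  S.transpose * (S * S.transpose)⁻¹

/-- The matrix with columns `y_i - d_i`. -/
def dataResidual {p T : ℕ} (yd : ℤ → Fin p → ℝ) (d : Fin T → Fin p → ℝ) :
    Matrix (Fin p) (Fin T) ℝ :=
  Matrix.of fun b i => yd ((i : ℕ) + 1) b - d i b

/-- A disturbance trajectory is consistent with the data if `(H(y) - H(d)) (I - S† S) = 0`. -/
def IsConsistent {m p τ T : ℕ} (ud : ℤ → Fin m → ℝ) (yd : ℤ → Fin p → ℝ)
    (d : Fin T → Fin p → ℝ) : Prop :=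
  dataResidual yd d * (1 - rightInv (dataS τ T ud yd) * dataS τ T ud yd) = 0

/-- Prior knowledge `G₁ [Φ Ψ] G₂ ≤ G₃` (componentwise) about the system parameters; without any
rows it is void. -/
def PriorKnowledge {m p τ n₁ n₂ : ℕ} (G₁ : Matrix (Fin n₁) (Fin p) ℝ)
    (G₂ : Matrix (XiIdx m p τ ⊕ Fin m) (Fin n₂) ℝ) (G₃ : Matrix (Fin n₁) (Fin n₂) ℝ)
    (M : Matrix (Fin p) (XiIdx m p τ ⊕ Fin m) ℝ) : Prop :=
  ∀ i j, (G₁ * M * G₂) i j ≤ G₃ i j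

/-- The system parameters `[Φ Ψ] = (H(y) - H(d)) S†` that arise from the consistent disturbance
trajectories `d` with values in the disturbance set, and that respect the prior knowledge. -/
def consistentParams {m p τ T n₁ n₂ : ℕ} (ud : ℤ → Fin m → ℝ) (yd : ℤ → Fin p → ℝ)
    (D : Set (Fin p → ℝ)) (G₁ : Matrix (Fin n₁) (Fin p) ℝ)
    (G₂ : Matrix (XiIdx m p τ ⊕ Fin m) (Fin n₂) ℝ) (G₃ : Matrix (Fin n₁) (Fin n₂) ℝ) :
    Set (Matrix (Fin p) (XiIdx m p τ ⊕ Fin m) ℝ) :=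
  {M | ∃ d : Fin T → Fin p → ℝ, (∀ i, d i ∈ D) ∧ IsConsistent (τ := τ) ud yd d ∧
    M = dataResidual yd d * rightInv (dataS τ T ud yd) ∧ PriorKnowledge G₁ G₂ G₃ M}

/-! ### The predictive controller -/

/-- The (unrestricted) data of the control problem: true system parameters `Φ`, `Ψ`; vertices
`V j = [Φ_j Ψ_j]` of the polytope of system parameters; weights `Q`, `R`, `P`; prestabilizing gain
`K`; the disturbance set `{d | Gd d ≤ gd}`; the aggregate constraint set `{GC col(ξ, v) ≤ gC}` on
extended state and correction inputs; the set `{ξ | GX ξ ≤ gX}` of initial extended states.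
`τ` is the number of past inputs and outputs in the extended state, `L` the prediction horizon. -/
structure DPC (m p τ L Nv nD nC nX : ℕ) where
  Φ : Matrix (Fin p) (XiIdx m p τ) ℝ
  Ψ : Matrix (Fin p) (Fin m) ℝ
  V : Fin Nv → Matrix (Fin p) (XiIdx m p τ ⊕ Fin m) ℝ
  Q : Matrix (Fin p) (Fin p) ℝ
  R : Matrix (Fin m) (Fin m) ℝ
  P : Matrix (XiIdx m p τ) (XiIdx m p τ) ℝ
  K : Matrix (Fin m) (XiIdx m p τ) ℝ
  Gd : Matrix (Fin nD) (Fin p) ℝ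
  gd : Fin nD → ℝ
  GC : Matrix (Fin nC) (XiIdx m p τ ⊕ (Fin L × Fin m)) ℝ
  gC : Fin nC → ℝ
  GX : Matrix (Fin nX) (XiIdx m p τ) ℝ
  gX : Fin nX → ℝ

/-- A sequence `v_0, …, v_{L-1}` of correction inputs, read as zero from `L` on. -/
def pad {m L : ℕ} (v : Fin L → Fin m → ℝ) (l : ℕ) : Fin m → ℝ :=
  if h : l < L then v ⟨l, h⟩ else 0

namespace DPC

variable {m p τ L Nv nD nC nX : ℕ} (S : DPC m p τ L Nv nD nC nX)

/-- `Ã` of the true system. -/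
def A : Matrix (XiIdx m p τ) (XiIdx m p τ) ℝ := Atilde S.Φ

/-- `B̃` of the true system. -/
def B : Matrix (XiIdx m p τ) (Fin m) ℝ := Btilde S.Ψ

/-- `Ẽ`, with the dimensions of `S`. -/
def E (_S : DPC m p τ L Nv nD nC nX) : Matrix (XiIdx m p τ) (Fin p) ℝ := Etilde

/-- `Ã_cl = Ã + B̃ K` of the true system. -/
def Acl : Matrix (XiIdx m p τ) (XiIdx m p τ) ℝ := S.A + S.B * S.K

/-- `Ã_j`. -/
def Av (j : Fin Nv) : Matrix (XiIdx m p τ) (XiIdx m p τ) ℝ := Atilde (S.V j).toCols₁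

/-- `B̃_j`. -/
def Bv (j : Fin Nv) : Matrix (XiIdx m p τ) (Fin m) ℝ := Btilde (S.V j).toCols₂

/-- `Ã_{cl,j} = Ã_j + B̃_j K`. -/
def Aclv (j : Fin Nv) : Matrix (XiIdx m p τ) (XiIdx m p τ) ℝ := S.Av j + S.Bv j * S.K

/-- The matrix polytope with vertices `[Ã_j B̃_j]`. -/
def matPolytope : Set (Matrix (XiIdx m p τ) (XiIdx m p τ ⊕ Fin m) ℝ) :=
  convexHull ℝ (Set.range fun j => Matrix.fromCols (S.Av j) (S.Bv j))

/-- The disturbance set. -/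
def dset : Set (Fin p → ℝ) := polyhedron S.Gd S.gd

/-- The candidate domain of attraction. -/
def roa : Set (XiIdx m p τ → ℝ) := polyhedron S.GX S.gX

/-- `col(ξ, v)` satisfies the aggregate constraints. -/
def InC (ξ : XiIdx m p τ → ℝ) (v : Fin L → Fin m → ℝ) : Prop :=
  Sum.elim ξ (fun q => v q.1 q.2) ∈ polyhedron S.GC S.gC

/-- The pair of extended state and first correction input is robustly mapped into `S.roa`. -/
def RobustFirstStep (ξ : XiIdx m p τ → ℝ) (v₀ : Fin m → ℝ) : Prop :=
  ∀ d ∈ S.dset, ∀ j, (S.Aclv j).mulVec ξ + (S.Bv j).mulVec v₀ + S.E.mulVec d ∈ S.roa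

/-- `S.roa` is robust control invariant for the matrix vertices, with extended state and first
correction input in the projection of the aggregate constraint set. -/
def IsRobustControlInvariant : Prop :=
  ∀ ξ ∈ S.roa, ∃ v₀ : Fin m → ℝ,
    (∃ v : Fin L → Fin m → ℝ, pad v 0 = v₀ ∧ S.InC ξ v) ∧ S.RobustFirstStep ξ v₀

/-- The feasible correction input sequences: aggregate constraints and first-step constraint. -/
def feasible (ξ : XiIdx m p τ → ℝ) : Set (Fin L → Fin m → ℝ) :=
  {v | S.InC ξ v ∧ S.RobustFirstStep ξ (pad v 0)}

/-- Predicted extended states for initial state `ξ`, correction inputs `v`, disturbances `δ`. -/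
def predState (ξ : XiIdx m p τ → ℝ) (v : Fin L → Fin m → ℝ) (δ : ℕ → Fin p → ℝ) :
    ℕ → XiIdx m p τ → ℝ
  | 0 => ξ
  | l + 1 =>
      S.A.mulVec (predState ξ v δ l) + S.B.mulVec (S.K.mulVec (predState ξ v δ l) + pad v l) +
        S.E.mulVec (δ l)

/-- Predicted inputs. -/
def predInput (ξ : XiIdx m p τ → ℝ) (v : Fin L → Fin m → ℝ) (δ : ℕ → Fin p → ℝ) (l : ℕ) :
    Fin m → ℝ :=
  S.K.mulVec (S.predState ξ v δ l) + pad v l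

/-- Predicted outputs. -/
def predOutput (ξ : XiIdx m p τ → ℝ) (v : Fin L → Fin m → ℝ) (δ : ℕ → Fin p → ℝ) (l : ℕ) :
    Fin p → ℝ :=
  S.Φ.mulVec (S.predState ξ v δ l) + S.Ψ.mulVec (S.predInput ξ v δ l) + δ l

/-- The expected finite-horizon cost for independent disturbances with distribution `μ`. -/
def cost (μ : ProbabilityMeasure (Fin p → ℝ)) (ξ : XiIdx m p τ → ℝ) (v : Fin L → Fin m → ℝ) : ℝ :=
  ∫ δ, ((∑ l ∈ Finset.range L,
      (wsq S.Q (S.predOutput ξ v δ l) + wsq S.R (S.predInput ξ v δ l))) +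
      wsq S.P (S.predState ξ v δ L))
    ∂(Measure.infinitePi fun _ : ℕ => (μ : Measure (Fin p → ℝ)))

/-- The optimal cost. -/
def optCost (μ : ProbabilityMeasure (Fin p → ℝ)) (ξ : XiIdx m p τ → ℝ) : ℝ :=
  sInf (S.cost μ ξ '' S.feasible ξ)

/-- `vstar` selects a solution of the optimal control problem at each state of `S.roa`. -/
def IsOptimal (μ : ProbabilityMeasure (Fin p → ℝ))
    (vstar : (XiIdx m p τ → ℝ) → Fin L → Fin m → ℝ) : Prop :=
  ∀ ξ ∈ S.roa, vstar ξ ∈ S.feasible ξ ∧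
    ∀ v ∈ S.feasible ξ, S.cost μ ξ (vstar ξ) ≤ S.cost μ ξ v

/-- The control law `κ(ξ) = K ξ + v*_0(ξ)`. -/
def control (vstar : (XiIdx m p τ → ℝ) → Fin L → Fin m → ℝ) (ξ : XiIdx m p τ → ℝ) : Fin m → ℝ :=
  S.K.mulVec ξ + pad (vstar ξ) 0

/-- The closed-loop dynamics `ξ⁺ = Ã ξ + B̃ κ(ξ) + Ẽ d`. -/
def closedLoop (vstar : (XiIdx m p τ → ℝ) → Fin L → Fin m → ℝ) (ξ : XiIdx m p τ → ℝ)
    (d : Fin p → ℝ) : XiIdx m p τ → ℝ :=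
  S.A.mulVec ξ + S.B.mulVec (S.control vstar ξ) + S.E.mulVec d

/-- The shifted candidate solution `ṽ_l = v_{l+1} + K Ã_cl^l Ẽ d` (with `v_L = 0`). -/
def candidate (v : Fin L → Fin m → ℝ) (d : Fin p → ℝ) : Fin L → Fin m → ℝ := fun l =>
  pad v (l + 1) + (S.K * S.Acl ^ (l : ℕ) * S.E).mulVec d

/-- From every state of `S.roa`, the probability that the candidate solution is not feasible at the
successor state is at most `ε`. -/
def CandidateInfeasibleLE (μ : ProbabilityMeasure (Fin p → ℝ))
    (vstar : (XiIdx m p τ → ℝ) → Fin L → Fin m → ℝ) (ε : ℝ) : Prop :=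
  ∀ ξ ∈ S.roa, (μ : Measure (Fin p → ℝ)).real
    {d | S.candidate (vstar ξ) d ∉ S.feasible (S.closedLoop vstar ξ d)} ≤ ε

/-- The disturbance has zero mean and takes values in the disturbance set. -/
def IsDisturbanceLaw (μ : ProbabilityMeasure (Fin p → ℝ)) : Prop :=
  (∀ᵐ d ∂(μ : Measure (Fin p → ℝ)), d ∈ S.dset) ∧
    ∀ i, ∫ d, d i ∂(μ : Measure (Fin p → ℝ)) = 0

/-- `‖ξ‖²_{Pl} ≤ J*(ξ) - c ≤ ‖ξ‖²_{Pu}` on `S.roa`, for some constant `c`. -/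
def CostBounded (μ : ProbabilityMeasure (Fin p → ℝ)) (Pl Pu : Matrix (XiIdx m p τ) (XiIdx m p τ) ℝ) :
    Prop :=
  ∃ c : ℝ, ∀ ξ ∈ S.roa, wsq Pl ξ ≤ S.optCost μ ξ - c ∧ S.optCost μ ξ - c ≤ wsq Pu ξ

/-- Terminal cost decrease: for all vertices,
`Ã_{cl,j}ᵀ P Ã_{cl,j} - P + Kᵀ R K + Ã_{cl,j}ᵀ Ẽ Q Ẽᵀ Ã_{cl,j} ≺ 0`. -/
def TerminalDecrease : Prop :=
  ∀ j, (-((S.Aclv j).transpose * S.P * S.Aclv j - S.P + S.K.transpose * S.R * S.K +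
    (S.Aclv j).transpose * S.E * S.Q * S.E.transpose * S.Aclv j)).PosDef

/-- `W(ξ) = ‖ξ‖²_{PW}` is an input-output-to-state-stability Lyapunov function of the system. -/
def IsIOSSLyapunov (PW : Matrix (XiIdx m p τ) (XiIdx m p τ) ℝ) (cu cy cd : ℝ) : Prop :=
  ∀ (ξ : XiIdx m p τ → ℝ) (u : Fin m → ℝ) (d : Fin p → ℝ),
    wsq PW (S.A.mulVec ξ + S.B.mulVec u + S.E.mulVec d) - wsq PW ξ ≤
      -(1 / 2) * euclNorm ξ ^ 2 + cu * euclNorm u ^ 2 +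
        cy * euclNorm (S.Φ.mulVec ξ + S.Ψ.mulVec u + d) ^ 2 + cd * euclNorm d ^ 2

/-- `c_S = min(λ_min(Q), λ_min(R)) / max(c_u, c_y)`. -/
def cS (cu cy : ℝ) : ℝ := min (evMin S.Q) (evMin S.R) / max cu cy

/-- The matrix `Q_S` for given `Ã` and `B̃`. -/
def QS (Pl Pu : Matrix (XiIdx m p τ) (XiIdx m p τ) ℝ) (cu cy ε : ℝ)
    (At : Matrix (XiIdx m p τ) (XiIdx m p τ) ℝ) (Bt : Matrix (XiIdx m p τ) (Fin m) ℝ) :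
    Matrix (XiIdx m p τ ⊕ Fin m) (XiIdx m p τ ⊕ Fin m) ℝ :=
  Matrix.fromBlocks ((S.cS cu cy / 2) • (1 : Matrix (XiIdx m p τ) (XiIdx m p τ) ℝ)) 0 0
      (S.R - (S.cS cu cy * cu) • (1 : Matrix (Fin m) (Fin m) ℝ)) -
    (ε / (1 - ε)) • Matrix.fromBlocks (At.transpose * Pu * At - Pl) (At.transpose * Pu * Bt)
      (Bt.transpose * Pu * At) (Bt.transpose * Pu * Bt)

end DPC

/-! ### Robust asymptotic stability in expectation -/

/-- The solution of `x_{k+1} = f(x_k, d_k)`. -/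
def trajectory {X D : Type*} (f : X → D → X) (x₀ : X) (d : ℕ → D) : ℕ → X
  | 0 => x₀
  | k + 1 => f (trajectory f x₀ d k) (d k)

/-- The second-moment matrix `Σ = E[d dᵀ]`. -/
def covMatrix {p : ℕ} (μ : ProbabilityMeasure (Fin p → ℝ)) : Matrix (Fin p) (Fin p) ℝ :=
  Matrix.of fun i j => ∫ d, d i * d j ∂(μ : Measure (Fin p → ℝ))

/-- The origin is robustly asymptotically stable in expectation on `X` for `x⁺ = f(x, d)`: `X` is a
closed robust positive invariant set (for disturbances in `Dset`) with the origin in its interior,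
and `E‖x_k‖ ≤ β(‖x₀‖, k) + ρ(tr Σ)` with `β` of class `KL` and `ρ` of class `K`, where the `d_k` are
independent with a common distribution `μ`. The functions `β` and `ρ` serve all the distributions
in `laws`, so that the dependence on `tr Σ` is meaningful; stability for one fixed distribution is
the case where `laws` is a singleton. -/
def IsRASiE {ι : Type*} [Fintype ι] {p : ℕ} (f : (ι → ℝ) → (Fin p → ℝ) → ι → ℝ)
    (X : Set (ι → ℝ)) (Dset : Set (Fin p → ℝ)) (laws : Set (ProbabilityMeasure (Fin p → ℝ))) :
    Prop :=
  IsClosed X ∧ (0 : ι → ℝ) ∈ interior X ∧ (∀ x ∈ X, ∀ d ∈ Dset, f x d ∈ X) ∧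
  ∃ (β : ℝ → ℝ → ℝ) (ρ : ℝ → ℝ), IsClassKL β ∧ IsClassK ρ ∧
    ∀ μ ∈ laws, ∀ x₀ ∈ X, ∀ k : ℕ,
      Integrable (fun δ => euclNorm (trajectory f x₀ δ k))
        (Measure.infinitePi fun _ : ℕ => (μ : Measure (Fin p → ℝ))) ∧
      ∫ δ, euclNorm (trajectory f x₀ δ k)
          ∂(Measure.infinitePi fun _ : ℕ => (μ : Measure (Fin p → ℝ))) ≤
        β (euclNorm x₀) k + ρ (covMatrix μ).trace

end

/-! ### Quadratic forms on finite-dimensional spaces -/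

section QuadraticForms

/-! The argument is a Lyapunov drift estimate. The disturbance has mean zero and predictions are
affine in it, so the expected cost is the cost `nomCost` of the undisturbed prediction plus a
constant independent of state and decision (`IsDisturbanceLaw.cost_eq`). Hence the minimizer and all
constants derived from it do not depend on the distribution, which gives the uniformity of `β` and
`ρ`.

The recorded disturbances are themselves a consistent trajectory, so the true parameters are a
convex combination of the vertices (`exists_isVertexWeights`). Robust invariance passes to the true
system by convexity of the region, and the terminal inequality by Jensen. The matrix condition is
evaluated at the true parameters.

The Lyapunov function is the optimal nominal cost, normalized at the origin, plus `α = (1 - ε) c_S`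
times the detectability function `W`. If the shifted candidate is feasible, the cost falls by the
stage cost up to a disturbance error. If not, the new cost is still at most the `Pu`-square of the
successor. The second event has probability at most `ε`, and positivity of `Q_S` is what pays for it
(`exists_nominal_decrease`); `W` turns the stage cost, which sees only inputs and outputs, into
decrease in the whole state.

Terms linear in the disturbance do not average out, since feasibility of the candidate depends on
the disturbance. Young's inequality absorbs them into a small multiple of the squared norm of state
and optimal corrections. That norm is bounded by the state and the optimal nominal cost at the
origin, which need not vanish because zero correction need not be feasible. A dichotomy bounds this
cost by a multiple of `tr Σ` (`exists_nomCost_zero_le`): it is zero, or every admissible law has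
variance bounded away from zero.

The resulting geometric drift (`exists_lyap_drift`) is iterated using independence of the current
state and disturbance. This needs a measurable feedback, which quadratic growth around the minimizer
supplies. Taking roots of the second moment gives the stability bound. -/

theorem QuadraticForm.apply_add {E : Type*} [AddCommGroup E] [Module ℝ E] (q : QuadraticForm ℝ E)
    (x y : E) : q (x + y) = q x + q y + QuadraticMap.polarBilin q x y := by
  simp [QuadraticMap.polar]

theorem QuadraticForm.apply_add_add_apply_sub {E : Type*} [AddCommGroup E] [Module ℝ E]
    (q : QuadraticForm ℝ E) (x y : E) : q (x + y) + q (x - y) = 2 * q x + 2 * q y := by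
  have h1 := q.apply_add x y
  have h2 := q.apply_add x (-y)
  rw [QuadraticMap.map_neg, LinearMap.map_neg] at h2
  rw [sub_eq_add_neg]
  linarith

variable {E F D : Type*} [NormedAddCommGroup E] [NormedSpace ℝ E]
  [NormedAddCommGroup F] [NormedSpace ℝ F] [NormedAddCommGroup D] [NormedSpace ℝ D]

variable [FiniteDimensional ℝ E]

theorem LinearMap.exists_bound_of_finiteDimensional (f : E →ₗ[ℝ] F) :
    ∃ C, 0 ≤ C ∧ ∀ x, ‖f x‖ ≤ C * ‖x‖ :=
  ⟨‖f.toContinuousLinearMap‖, norm_nonneg _, fun x => f.toContinuousLinearMap.le_opNorm x⟩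

theorem LinearMap.exists_bound₂_of_finiteDimensional [FiniteDimensional ℝ F]
    (b : E →ₗ[ℝ] F →ₗ[ℝ] ℝ) :
    ∃ C, 0 ≤ C ∧ ∀ x y, |b x y| ≤ C * ‖x‖ * ‖y‖ := by
  obtain ⟨C, hC, h⟩ := LinearMap.exists_bound_of_finiteDimensional
    ((LinearMap.toContinuousLinearMap (𝕜 := ℝ) (E := F) (F' := ℝ)).toLinearMap ∘ₗ b)
  refine ⟨C, hC, fun x y => ?_⟩
  have h1 := ((LinearMap.toContinuousLinearMap (𝕜 := ℝ) (E := F) (F' := ℝ)) (b x)).le_opNorm y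
  have h2 := h x
  simp only [LinearMap.comp_apply, LinearEquiv.coe_coe] at h2
  calc |b x y| ≤ _ := h1
    _ ≤ _ := by gcongr

namespace QuadraticForm

variable (q : QuadraticForm ℝ E)

theorem exists_abs_le : ∃ C, 0 ≤ C ∧ ∀ x, |q x| ≤ C * ‖x‖ ^ 2 := by
  obtain ⟨C, hC, h⟩ := LinearMap.exists_bound₂_of_finiteDimensional (QuadraticMap.polarBilin q)
  refine ⟨C, hC, fun x => ?_⟩
  have h1 := h x x
  have h2 : QuadraticMap.polarBilin q x x = 2 * q x := by
    simp [QuadraticMap.polar_self]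
  rw [h2, abs_mul, abs_two] at h1
  have := abs_nonneg (q x)
  nlinarith

theorem continuous_of_finiteDimensional : Continuous q := by
  obtain ⟨C, hC, h⟩ := LinearMap.exists_bound₂_of_finiteDimensional (QuadraticMap.polarBilin q)
  obtain ⟨C', hC', h'⟩ := exists_abs_le q
  rw [continuous_iff_continuousAt]
  intro x
  rw [ContinuousAt, tendsto_iff_norm_sub_tendsto_zero]
  have hlim : Tendsto (fun y => C' * ‖y - x‖ ^ 2 + C * ‖x‖ * ‖y - x‖) (𝓝 x) (𝓝 0) := by
    have : Continuous (fun y => C' * ‖y - x‖ ^ 2 + C * ‖x‖ * ‖y - x‖) := by fun_prop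
    simpa using this.tendsto x
  refine squeeze_zero (fun _ => norm_nonneg _) (fun y => ?_) hlim
  have e := apply_add q x (y - x)
  rw [add_sub_cancel] at e
  rw [e, Real.norm_eq_abs, add_assoc, add_sub_cancel_left]
  exact (abs_add_le _ _).trans (add_le_add (h' _) (h _ _))

theorem exists_le_of_posDef (hq : QuadraticMap.PosDef q) : ∃ c, 0 < c ∧ ∀ x, c * ‖x‖ ^ 2 ≤ q x := by
  -- In the trivial space the unit sphere is empty and has no minimizer; otherwise homogeneity
  -- extends the minimum on the sphere.
  rcases subsingleton_or_nontrivial E with hE | hE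
  · refine ⟨1, one_pos, fun x => ?_⟩
    simp [Subsingleton.elim x 0]
  obtain ⟨x₀, hx₀, hmin⟩ := (isCompact_sphere (0 : E) 1).exists_isMinOn
    (NormedSpace.sphere_nonempty.2 zero_le_one) (continuous_of_finiteDimensional q).continuousOn
  have hx₀' : ‖x₀‖ = 1 := by simpa using hx₀
  refine ⟨q x₀, hq x₀ (by rintro rfl; simp at hx₀'), fun x => ?_⟩
  rcases eq_or_ne x 0 with rfl | hx
  · simp
  have hn : ‖x‖ ≠ 0 := norm_ne_zero_iff.2 hx
  have h1 : q x₀ ≤ q (‖x‖⁻¹ • x) := hmin (by simp [norm_smul, hn])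
  rw [QuadraticMap.map_smul, smul_eq_mul] at h1
  calc q x₀ * ‖x‖ ^ 2 ≤ (‖x‖⁻¹ * ‖x‖⁻¹ * q x) * ‖x‖ ^ 2 := by gcongr
    _ = q x := by field_simp

/-- Young's inequality for a perturbed quadratic form. -/
theorem exists_apply_add_le [FiniteDimensional ℝ F] [FiniteDimensional ℝ D]
    (T : F →ₗ[ℝ] E) (H : D →ₗ[ℝ] E) {θ : ℝ} (hθ : 0 < θ) :
    ∃ C, 0 ≤ C ∧ ∀ x d, q (T x + H d) ≤ q (T x) + θ * ‖x‖ ^ 2 + C * ‖d‖ ^ 2 := by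
  obtain ⟨C₁, hC₁, h₁⟩ := LinearMap.exists_bound₂_of_finiteDimensional (QuadraticMap.polarBilin q)
  obtain ⟨C₂, hC₂, h₂⟩ := exists_abs_le q
  obtain ⟨t, ht, hT⟩ := T.exists_bound_of_finiteDimensional
  obtain ⟨h, hh, hH⟩ := H.exists_bound_of_finiteDimensional
  -- The first summand bounds `q (H d)`; the second is the price of absorbing the polar term, at
  -- most `C₁ * t * h * ‖x‖ * ‖d‖`, into `θ * ‖x‖ ^ 2`.
  refine ⟨C₂ * h ^ 2 + (C₁ * t * h) ^ 2 / θ, by positivity, fun x d => ?_⟩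
  rw [apply_add]
  have e1 : q (H d) ≤ C₂ * (h * ‖d‖) ^ 2 :=
    (le_abs_self _).trans ((h₂ _).trans (by gcongr; exact hH d))
  have e2 : QuadraticMap.polarBilin q (T x) (H d) ≤ C₁ * (t * ‖x‖) * (h * ‖d‖) :=
    (le_abs_self _).trans ((h₁ _ _).trans (by gcongr; exacts [hT x, hH d]))
  have e3 : C₁ * (t * ‖x‖) * (h * ‖d‖) ≤ θ * ‖x‖ ^ 2 + (C₁ * t * h) ^ 2 / θ * ‖d‖ ^ 2 := by
    have := sq_nonneg (θ * ‖x‖ - (C₁ * t * h) * ‖d‖)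
    have e : θ * ‖x‖ ^ 2 + (C₁ * t * h) ^ 2 / θ * ‖d‖ ^ 2 =
        (θ ^ 2 * ‖x‖ ^ 2 + (C₁ * t * h) ^ 2 * ‖d‖ ^ 2) / θ := by field_simp
    rw [e, le_div_iff₀ hθ]
    have : 0 ≤ C₁ * t * h * ‖x‖ * ‖d‖ * θ := by positivity
    nlinarith
  nlinarith

end QuadraticForm

end QuadraticForms

/-! ### Weighted squares -/

section WeightedSquares

variable {ι κ : Type*} [Fintype ι] [Fintype κ]

theorem euclNorm_sq (x : ι → ℝ) : euclNorm x ^ 2 = x ⬝ᵥ x := by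
  rw [euclNorm, EuclideanSpace.norm_sq_eq]
  simp [dotProduct, sq]

theorem euclNorm_nonneg (x : ι → ℝ) : 0 ≤ euclNorm x := norm_nonneg _

theorem continuous_euclNorm : Continuous (euclNorm : (ι → ℝ) → ℝ) :=
  continuous_norm.comp (PiLp.continuous_toLp 2 _)

theorem wsq_one [DecidableEq ι] (x : ι → ℝ) : wsq 1 x = euclNorm x ^ 2 := by
  simp [wsq, euclNorm_sq]

/-- `wsq M` as a quadratic form. -/
noncomputable def wsqForm [DecidableEq ι] (M : Matrix ι ι ℝ) : QuadraticForm ℝ (ι → ℝ) :=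
  M.toQuadraticForm'

@[simp]
theorem wsqForm_apply [DecidableEq ι] (M : Matrix ι ι ℝ) (x : ι → ℝ) : wsqForm M x = wsq M x := by
  simp [wsqForm, wsq, Matrix.toQuadraticForm', Matrix.toLinearMap₂'_apply']

theorem wsq_nonneg {M : Matrix ι ι ℝ} (hM : M.PosSemidef) (x : ι → ℝ) : 0 ≤ wsq M x := by
  simpa [wsq] using hM.dotProduct_mulVec_nonneg x

theorem wsq_pos {M : Matrix ι ι ℝ} (hM : M.PosDef) {x : ι → ℝ} (hx : x ≠ 0) : 0 < wsq M x := by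
  simpa [wsq] using hM.dotProduct_mulVec_pos hx

theorem wsqForm_posDef [DecidableEq ι] {M : Matrix ι ι ℝ} (hM : M.PosDef) :
    QuadraticMap.PosDef (wsqForm M) := fun x hx => by
  rw [wsqForm_apply]; exact wsq_pos hM hx

theorem continuous_wsq (M : Matrix ι ι ℝ) : Continuous (wsq M) := by
  classical
  exact (QuadraticForm.continuous_of_finiteDimensional (wsqForm M)).congr (wsqForm_apply M)

@[simp]
theorem wsq_zero (M : Matrix ι ι ℝ) : wsq M 0 = 0 := by simp [wsq]

theorem eq_zero_of_wsq_eq_zero {M : Matrix ι ι ℝ} (hM : M.PosDef) {x : ι → ℝ} (h : wsq M x = 0) :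
    x = 0 := by
  by_contra hx
  exact (wsq_pos hM hx).ne' h

theorem wsq_transpose_mul_mul (N : Matrix κ ι ℝ) (M : Matrix κ κ ℝ) (x : ι → ℝ) :
    wsq (N.transpose * M * N) x = wsq M (N.mulVec x) := by
  simp only [wsq, ← Matrix.mulVec_mulVec, Matrix.dotProduct_mulVec, Matrix.vecMul_transpose]

theorem wsq_sub (M N : Matrix ι ι ℝ) (x : ι → ℝ) : wsq (M - N) x = wsq M x - wsq N x := by
  simp [wsq, Matrix.sub_mulVec, dotProduct_sub]

theorem wsq_add (M N : Matrix ι ι ℝ) (x : ι → ℝ) : wsq (M + N) x = wsq M x + wsq N x := by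
  simp [wsq, Matrix.add_mulVec, dotProduct_add]

theorem wsq_neg (M : Matrix ι ι ℝ) (x : ι → ℝ) : wsq (-M) x = -wsq M x := by
  simp [wsq, Matrix.neg_mulVec]

theorem wsq_smul (c : ℝ) (M : Matrix ι ι ℝ) (x : ι → ℝ) : wsq (c • M) x = c * wsq M x := by
  simp [wsq, Matrix.smul_mulVec]

/-- Jensen's inequality for a positive semidefinite weighted square. -/
theorem wsq_sum_smul_le {J : Type*} [Fintype J] {M : Matrix ι ι ℝ} (hM : M.PosSemidef)
    {w : J → ℝ} (hw : ∀ j, 0 ≤ w j) (hw1 : ∑ j, w j = 1) (x : J → ι → ℝ) :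
    wsq M (∑ j, w j • x j) ≤ ∑ j, w j * wsq M (x j) := by
  classical
  set z := ∑ j, w j • x j with hz
  -- Expansion around the barycenter `z`: the linear term averages to zero and the quadratic
  -- remainder is nonnegative.
  have hexp : ∀ j, wsq M (x j) = wsq M z + wsq M (x j - z) +
      QuadraticMap.polarBilin (wsqForm M) z (x j - z) := fun j => by
    simpa using QuadraticForm.apply_add (wsqForm M) z (x j - z)
  have hlin : ∑ j, w j * QuadraticMap.polarBilin (wsqForm M) z (x j - z) = 0 := by
    have : ∑ j, w j • (x j - z) = 0 := by
      simp only [smul_sub, Finset.sum_sub_distrib, ← Finset.sum_smul, hw1, one_smul, ← hz, sub_self]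
    have h2 := congrArg (QuadraticMap.polarBilin (wsqForm M) z) this
    rw [map_sum, map_zero] at h2
    simpa only [map_smul, smul_eq_mul] using h2
  calc wsq M z = ∑ j, w j * wsq M z := by rw [← Finset.sum_mul, hw1, one_mul]
    _ ≤ ∑ j, w j * (wsq M z + wsq M (x j - z)) := by
      gcongr with j
      · exact hw j
      · linarith [wsq_nonneg hM (x j - z)]
    _ = ∑ j, w j * wsq M (x j) := by
      simp_rw [hexp, mul_add, Finset.sum_add_distrib, hlin, add_zero]

variable [DecidableEq ι]

theorem evMin_pos [Nonempty ι] {M : Matrix ι ι ℝ} (hM : M.PosDef) : 0 < evMin M := by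
  rw [evMin, hM.1.spectrum_real_eq_range_eigenvalues]
  obtain ⟨i, hi⟩ := (Set.range_nonempty _).csInf_mem (Set.finite_range hM.1.eigenvalues)
  rw [← hi]
  exact hM.eigenvalues_pos i

/-- Subtracting the smallest eigenvalue times the identity shifts the spectrum into the nonnegative
half-line. -/
theorem evMin_mul_le {M : Matrix ι ι ℝ} (hM : M.IsHermitian) (x : ι → ℝ) :
    evMin M * euclNorm x ^ 2 ≤ wsq M x := by
  have hpsd : (M - evMin M • (1 : Matrix ι ι ℝ)).PosSemidef := by
    rw [Matrix.posSemidef_iff_isHermitian_and_spectrum_nonneg]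
    refine ⟨hM.sub (by simp [Matrix.IsHermitian]), fun t ht => ?_⟩
    have : t + evMin M ∈ spectrum ℝ M := by
      rwa [spectrum.add_mem_iff, Algebra.algebraMap_eq_smul_one, neg_add_eq_sub]
    have hb : BddBelow (spectrum ℝ M) := by
      rw [hM.spectrum_real_eq_range_eigenvalues]
      exact (Set.finite_range _).bddBelow
    have := csInf_le hb this
    change 0 ≤ t
    rw [← evMin] at this
    linarith
  have := wsq_nonneg hpsd x
  rw [wsq_sub, wsq_smul, wsq_one] at this
  linarith

end WeightedSquares

/-! ### Polyhedra and convex combinations -/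

theorem isClosed_polyhedron {κ ι : Type*} [Fintype ι] (G : Matrix κ ι ℝ) (g : κ → ℝ) :
    IsClosed (polyhedron G g) :=
  isClosed_le (Continuous.matrix_mulVec continuous_const continuous_id) continuous_const

theorem convex_polyhedron {κ ι : Type*} [Fintype ι] (G : Matrix κ ι ℝ) (g : κ → ℝ) :
    Convex ℝ (polyhedron G g) :=
  (convex_Iic (𝕜 := ℝ) g).linear_preimage G.mulVecLin

theorem exists_weights_of_mem_convexHull_range {J E : Type*} [Fintype J] [AddCommGroup E]
    [Module ℝ E] {v : J → E} {x : E} (hx : x ∈ convexHull ℝ (Set.range v)) :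
    ∃ w : J → ℝ, (∀ j, 0 ≤ w j) ∧ ∑ j, w j = 1 ∧ ∑ j, w j • v j = x := by
  classical
  have hsub : convexHull ℝ (Set.range v) ⊆
      {x | ∃ w : J → ℝ, (∀ j, 0 ≤ w j) ∧ ∑ j, w j = 1 ∧ ∑ j, w j • v j = x} := by
    refine convexHull_min ?_ ?_
    · rintro _ ⟨i, rfl⟩
      refine ⟨Pi.single i 1, fun j => ?_, by simp, ?_⟩
      · by_cases h : j = i
        · subst h; simp
        · simp [Pi.single_eq_of_ne h]
      · rw [Finset.sum_eq_single i] <;> simp +contextual [Pi.single_eq_of_ne]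
    · rintro _ ⟨w, hw, hw1, rfl⟩ _ ⟨w', hw', hw1', rfl⟩ a b ha hb hab
      refine ⟨fun j => a * w j + b * w' j,
        fun j => add_nonneg (mul_nonneg ha (hw j)) (mul_nonneg hb (hw' j)), ?_, ?_⟩
      · rw [Finset.sum_add_distrib, ← Finset.mul_sum, ← Finset.mul_sum, hw1, hw1', mul_one, mul_one,
          hab]
      · simp only [add_smul, mul_smul, Finset.sum_add_distrib, Finset.smul_sum]
  exact hsub hx

/-- The Gram matrix has the same rank as `M`, so full row rank makes it invertible. -/
theorem mul_rightInv {ι κ : Type*} [Fintype ι] [DecidableEq ι] [Fintype κ] {M : Matrix ι κ ℝ}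
    (hM : M.rank = Fintype.card ι) : M * rightInv M = 1 := by
  have hrank : (M * M.transpose).rank = Fintype.card ι := by
    rw [Matrix.rank_self_mul_transpose, hM]
  have hsurj : Function.Surjective (M * M.transpose).mulVec := by
    have : LinearMap.range (M * M.transpose).mulVecLin = ⊤ :=
      Submodule.eq_top_of_finrank_eq (by
        rw [Module.finrank_fintype_fun_eq_card]; exact hrank)
    exact LinearMap.range_eq_top.1 this
  have hunit := (Matrix.isUnit_iff_isUnit_det _).1 (Matrix.mulVec_surjective_iff_isUnit.1 hsurj)
  rw [rightInv, ← Matrix.mul_assoc, Matrix.mul_nonsing_inv _ hunit]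

namespace DPC

variable {m p τ L Nv nD nC nX : ℕ} (S : DPC m p τ L Nv nD nC nX)

/-! ### The true system as a convex combination of the vertices -/

theorem isClosed_roa : IsClosed S.roa := isClosed_polyhedron _ _

theorem convex_roa : Convex ℝ S.roa := convex_polyhedron _ _

/-- `w` are convex weights that represent the true parameters by the vertices. -/
def IsVertexWeights (w : Fin Nv → ℝ) : Prop :=
  (∀ j, 0 ≤ w j) ∧ ∑ j, w j = 1 ∧ ∑ j, w j • S.V j = Matrix.fromCols S.Φ S.Ψ

/-- The recorded disturbances satisfy `H(y) - H(d) = [Φ Ψ] S`. Since `S S† = 1`, they are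
consistent, and the parameters they generate are exactly the true ones. -/
theorem exists_isVertexWeights {T n₁ n₂ : ℕ} (ud : ℤ → Fin m → ℝ) (yd : ℤ → Fin p → ℝ)
    (dd : Fin T → Fin p → ℝ) (hdd : ∀ i, dd i ∈ S.dset)
    (hdata : ∀ i : Fin T, yd ((i : ℕ) + 1) = S.Φ.mulVec (extState τ ud yd ((i : ℕ) + 1)) +
      S.Ψ.mulVec (ud ((i : ℕ) + 1)) + dd i)
    (hrank : (dataS τ T ud yd).rank = Fintype.card (XiIdx m p τ ⊕ Fin m))
    (G₁ : Matrix (Fin n₁) (Fin p) ℝ) (G₂ : Matrix (XiIdx m p τ ⊕ Fin m) (Fin n₂) ℝ)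
    (G₃ : Matrix (Fin n₁) (Fin n₂) ℝ)
    (hprior : PriorKnowledge G₁ G₂ G₃ (Matrix.fromCols S.Φ S.Ψ))
    (hV : consistentParams (T := T) ud yd S.dset G₁ G₂ G₃ ⊆ convexHull ℝ (Set.range S.V)) :
    ∃ w, S.IsVertexWeights w := by
  have hres : dataResidual yd dd = Matrix.fromCols S.Φ S.Ψ * dataS τ T ud yd := by
    rw [dataS, Matrix.fromCols_mul_fromRows]
    ext b i
    simp only [dataResidual, Matrix.of_apply, hdata i, Pi.add_apply, add_sub_cancel_right,
      Matrix.add_apply, Matrix.mul_apply, Matrix.mulVec, dotProduct]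
  have hinv := mul_rightInv hrank
  refine exists_weights_of_mem_convexHull_range (hV ⟨dd, hdd, ?_, ?_, hprior⟩)
  · rw [IsConsistent, hres, Matrix.mul_sub, Matrix.mul_one, Matrix.mul_assoc,
      ← Matrix.mul_assoc (dataS τ T ud yd), hinv, Matrix.one_mul, sub_self]
  · rw [hres, Matrix.mul_assoc, hinv, Matrix.mul_one]

variable {S} {w : Fin Nv → ℝ}

/-- The shift entries are common to all vertices and survive because the weights sum to one; the
remaining rows are linear in the parameters. -/
theorem IsVertexWeights.sum_Av (hw : S.IsVertexWeights w) : ∑ j, w j • S.Av j = S.A := by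
  obtain ⟨-, h1, h2⟩ := hw
  have hΦ : ∀ a c, ∑ j, w j * S.V j a (Sum.inl c) = S.Φ a c := fun a c => by
    have := congrFun (congrFun h2 a) (Sum.inl c)
    simpa [Matrix.sum_apply] using this
  ext r c
  rw [Matrix.sum_apply]
  rcases r with ⟨i, a⟩ | ⟨i, a⟩ <;> rcases c with ⟨k, b⟩ | ⟨k, b⟩ <;>
    simp only [Matrix.smul_apply, smul_eq_mul, Av, A, Atilde, ← Finset.sum_mul, h1, one_mul]
  all_goals
    split_ifs
    all_goals simp only [← Finset.sum_mul, h1, one_mul, Matrix.toCols₁_apply, hΦ]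

theorem IsVertexWeights.sum_Bv (hw : S.IsVertexWeights w) : ∑ j, w j • S.Bv j = S.B := by
  obtain ⟨-, h1, h2⟩ := hw
  have hΨ : ∀ a c, ∑ j, w j * S.V j a (Sum.inr c) = S.Ψ a c := fun a c => by
    have := congrFun (congrFun h2 a) (Sum.inr c)
    simpa [Matrix.sum_apply] using this
  ext r c
  rw [Matrix.sum_apply]
  rcases r with ⟨i, a⟩ | ⟨i, a⟩ <;>
    simp only [Matrix.smul_apply, smul_eq_mul, Bv, B, Btilde, ← Finset.sum_mul, h1, one_mul]
  split_ifs
  all_goals simp only [mul_zero, Finset.sum_const_zero, Matrix.toCols₂_apply, hΨ]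

theorem IsVertexWeights.sum_Aclv (hw : S.IsVertexWeights w) : ∑ j, w j • S.Aclv j = S.Acl := by
  simp only [Aclv, Acl, smul_add, Finset.sum_add_distrib, hw.sum_Av, ← Matrix.smul_mul,
    ← Matrix.sum_mul, hw.sum_Bv]

theorem IsVertexWeights.fromCols_mem_matPolytope (hw : S.IsVertexWeights w) :
    Matrix.fromCols S.A S.B ∈ S.matPolytope := by
  refine mem_convexHull_of_exists_fintype w (fun j => Matrix.fromCols (S.Av j) (S.Bv j)) hw.1 hw.2.1
    (fun j => ⟨j, rfl⟩) ?_
  rw [← hw.sum_Av, ← hw.sum_Bv]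
  ext r (c | c) <;> simp [Matrix.sum_apply]

theorem IsVertexWeights.mem_roa (hw : S.IsVertexWeights w) {ξ : XiIdx m p τ → ℝ}
    {v₀ : Fin m → ℝ} (h : S.RobustFirstStep ξ v₀) {d : Fin p → ℝ} (hd : d ∈ S.dset) :
    S.Acl.mulVec ξ + S.B.mulVec v₀ + S.E.mulVec d ∈ S.roa := by
  have := S.convex_roa.sum_mem (t := Finset.univ) (fun j _ => hw.1 j) hw.2.1
    (fun j _ => h d hd j)
  convert this using 1
  simp only [smul_add, Finset.sum_add_distrib, ← Finset.sum_smul, hw.2.1, one_smul]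
  rw [← hw.sum_Aclv, ← hw.sum_Bv]
  simp only [Matrix.sum_mulVec, Matrix.smul_mulVec]

/-- The transpose of `Ẽ` reads off the newest output block, at index `τ - 1`, where `Ã` and `B̃`
carry `Φ` and `Ψ`. -/
theorem transpose_E_mulVec_Acl_mulVec (hτ : 0 < τ) (ξ : XiIdx m p τ → ℝ) :
    S.E.transpose.mulVec (S.Acl.mulVec ξ) = S.Φ.mulVec ξ + S.Ψ.mulVec (S.K.mulVec ξ) := by
  have hE : ∀ x : XiIdx m p τ → ℝ, ∀ b, S.E.transpose.mulVec x b =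
      x (Sum.inr (⟨τ - 1, by omega⟩, b)) := fun x b => by
    simp only [Matrix.mulVec, dotProduct, Matrix.transpose_apply, E, Fintype.sum_sum_type, Etilde,
      zero_mul, Finset.sum_const_zero, zero_add]
    rw [Finset.sum_eq_single (⟨τ - 1, by omega⟩, b)]
    · simp [Nat.sub_add_cancel hτ]
    · rintro ⟨i, a⟩ - hne
      rw [if_neg, zero_mul]
      rintro ⟨h1, rfl⟩
      have h1 : (i : ℕ) + 1 = τ := h1
      exact hne (Prod.ext (Fin.ext (by show (i : ℕ) = τ - 1; omega)) rfl)
    · simp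
  ext b
  have hA : ∀ x, S.A.mulVec x (Sum.inr (⟨τ - 1, by omega⟩, b)) = S.Φ.mulVec x b := fun x => by
    simp [A, Matrix.mulVec, dotProduct, Atilde, Nat.sub_add_cancel hτ]
  have hB : ∀ u, S.B.mulVec u (Sum.inr (⟨τ - 1, by omega⟩, b)) = S.Ψ.mulVec u b := fun u => by
    simp [B, Matrix.mulVec, dotProduct, Btilde, Nat.sub_add_cancel hτ]
  rw [hE, Acl, Matrix.add_mulVec, ← Matrix.mulVec_mulVec, Pi.add_apply, Pi.add_apply, hA, hB]

/-- The terms that vary with the vertex are squares of vectors affine in the parameters, hence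
convex: Jensen carries the vertex inequalities to the true system. -/
theorem IsVertexWeights.terminal_decrease (hw : S.IsVertexWeights w) (hτ : 0 < τ)
    (hQ : S.Q.PosDef) (hP : S.P.PosDef) (hterm : S.TerminalDecrease) (ξ : XiIdx m p τ → ℝ) :
    wsq S.P (S.Acl.mulVec ξ) + wsq S.R (S.K.mulVec ξ) +
      wsq S.Q (S.Φ.mulVec ξ + S.Ψ.mulVec (S.K.mulVec ξ)) ≤ wsq S.P ξ := by
  have hj : ∀ j, wsq S.P ((S.Aclv j).mulVec ξ) +
      wsq S.Q (S.E.transpose.mulVec ((S.Aclv j).mulVec ξ)) ≤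
        wsq S.P ξ - wsq S.R (S.K.mulVec ξ) := by
    intro j
    have h := wsq_nonneg (hterm j).posSemidef ξ
    have e : (S.Aclv j).transpose * S.E * S.Q * S.E.transpose * S.Aclv j =
        (S.E.transpose * S.Aclv j).transpose * S.Q * (S.E.transpose * S.Aclv j) := by
      simp only [Matrix.transpose_mul, Matrix.transpose_transpose, Matrix.mul_assoc]
    rw [e, wsq_neg, wsq_add, wsq_add, wsq_sub, wsq_transpose_mul_mul, wsq_transpose_mul_mul,
      wsq_transpose_mul_mul, ← Matrix.mulVec_mulVec] at h
    linarith
  have hA : S.Acl.mulVec ξ = ∑ j, w j • (S.Aclv j).mulVec ξ := by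
    rw [← hw.sum_Aclv]
    simp only [Matrix.sum_mulVec, Matrix.smul_mulVec]
  have h1 := wsq_sum_smul_le hP.posSemidef hw.1 hw.2.1 fun j => (S.Aclv j).mulVec ξ
  have h2 := wsq_sum_smul_le hQ.posSemidef hw.1 hw.2.1
    fun j => S.E.transpose.mulVec ((S.Aclv j).mulVec ξ)
  have hE : S.E.transpose.mulVec (S.Acl.mulVec ξ) =
      ∑ j, w j • S.E.transpose.mulVec ((S.Aclv j).mulVec ξ) := by
    rw [hA, Matrix.mulVec_sum]
    simp only [Matrix.mulVec_smul]
  rw [← hE, transpose_E_mulVec_Acl_mulVec hτ] at h2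
  rw [← hA] at h1
  have h3 : ∑ j, w j * (wsq S.P ((S.Aclv j).mulVec ξ) +
      wsq S.Q (S.E.transpose.mulVec ((S.Aclv j).mulVec ξ))) ≤
      ∑ j, w j * (wsq S.P ξ - wsq S.R (S.K.mulVec ξ)) :=
    Finset.sum_le_sum fun j _ => mul_le_mul_of_nonneg_left (hj j) (hw.1 j)
  rw [← Finset.sum_mul, hw.2.1, one_mul] at h3
  simp only [mul_add, Finset.sum_add_distrib] at h3
  linarith

end DPC

namespace DPC

variable {m p τ L Nv nD nC nX : ℕ} (S : DPC m p τ L Nv nD nC nX)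

/-! ### The nominal prediction and its cost -/

/-- `pad` at a fixed time as a linear map. -/
def padLin (m L l : ℕ) : (Fin L → Fin m → ℝ) →ₗ[ℝ] Fin m → ℝ where
  toFun v := pad v l
  map_add' v w := by unfold pad; split_ifs <;> simp
  map_smul' c v := by unfold pad; split_ifs <;> simp

@[simp]
theorem padLin_apply (l : ℕ) (v : Fin L → Fin m → ℝ) : padLin m L l v = pad v l := rfl

theorem _root_.pad_zero (l : ℕ) : pad (0 : Fin L → Fin m → ℝ) l = 0 := by
  rw [← padLin_apply, map_zero]

/-- Pairs of an extended state and correction inputs. -/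
abbrev Dec (m p τ L : ℕ) : Type := (XiIdx m p τ → ℝ) × (Fin L → Fin m → ℝ)

/-- The undisturbed predicted states, as linear maps of initial state and correction inputs. -/
noncomputable def nomState : ℕ → Dec m p τ L →ₗ[ℝ] XiIdx m p τ → ℝ
  | 0 => LinearMap.fst ℝ _ _
  | l + 1 => S.Acl.mulVecLin ∘ₗ nomState l + S.B.mulVecLin ∘ₗ padLin m L l ∘ₗ LinearMap.snd ℝ _ _

/-- The undisturbed predicted inputs. -/
noncomputable def nomInput (l : ℕ) : Dec m p τ L →ₗ[ℝ] Fin m → ℝ :=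
  S.K.mulVecLin ∘ₗ S.nomState l + padLin m L l ∘ₗ LinearMap.snd ℝ _ _

/-- The undisturbed predicted outputs. -/
noncomputable def nomOutput (l : ℕ) : Dec m p τ L →ₗ[ℝ] Fin p → ℝ :=
  S.Φ.mulVecLin ∘ₗ S.nomState l + S.Ψ.mulVecLin ∘ₗ S.nomInput l

theorem nomState_zero (x : Dec m p τ L) : S.nomState 0 x = x.1 := rfl

theorem nomState_succ (l : ℕ) (x : Dec m p τ L) :
    S.nomState (l + 1) x = S.Acl.mulVec (S.nomState l x) + S.B.mulVec (pad x.2 l) := rfl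

theorem nomInput_apply (l : ℕ) (x : Dec m p τ L) :
    S.nomInput l x = S.K.mulVec (S.nomState l x) + pad x.2 l := rfl

theorem nomOutput_apply (l : ℕ) (x : Dec m p τ L) :
    S.nomOutput l x = S.Φ.mulVec (S.nomState l x) + S.Ψ.mulVec (S.nomInput l x) := rfl

theorem nomState_succ' (l : ℕ) (x : Dec m p τ L) :
    S.nomState (l + 1) x = S.A.mulVec (S.nomState l x) + S.B.mulVec (S.nomInput l x) := by
  rw [nomState_succ, nomInput_apply, Acl, Matrix.add_mulVec, Matrix.mulVec_add,
    Matrix.mulVec_mulVec, add_assoc]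

/-- The cost of the undisturbed prediction, as a quadratic form. -/
noncomputable def nomCost : QuadraticForm ℝ (Dec m p τ L) :=
  ∑ l ∈ Finset.range L, ((wsqForm S.Q).comp (S.nomOutput l) + (wsqForm S.R).comp (S.nomInput l)) +
    (wsqForm S.P).comp (S.nomState L)

theorem nomCost_apply (x : Dec m p τ L) : S.nomCost x =
    ∑ l ∈ Finset.range L, (wsq S.Q (S.nomOutput l x) + wsq S.R (S.nomInput l x)) +
      wsq S.P (S.nomState L x) := by
  simp [nomCost]

/-- Superposition: the response to initial state and corrections, plus the response to the
disturbances from rest. -/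
theorem predState_eq (ξ : XiIdx m p τ → ℝ) (v : Fin L → Fin m → ℝ) (δ : ℕ → Fin p → ℝ) (l : ℕ) :
    S.predState ξ v δ l = S.nomState l (ξ, v) + S.predState 0 0 δ l := by
  induction l with
  | zero => simp [predState, nomState_zero]
  | succ l ih =>
    rw [predState, ih, predState, nomState_succ', nomInput_apply, pad_zero]
    simp only [Matrix.mulVec_add, add_zero]
    abel

theorem predInput_eq (ξ : XiIdx m p τ → ℝ) (v : Fin L → Fin m → ℝ) (δ : ℕ → Fin p → ℝ) (l : ℕ) :
    S.predInput ξ v δ l = S.nomInput l (ξ, v) + S.predInput 0 0 δ l := by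
  rw [predInput, predState_eq, nomInput_apply, predInput, Matrix.mulVec_add, pad_zero]
  abel

theorem predOutput_eq (ξ : XiIdx m p τ → ℝ) (v : Fin L → Fin m → ℝ) (δ : ℕ → Fin p → ℝ) (l : ℕ) :
    S.predOutput ξ v δ l = S.nomOutput l (ξ, v) + S.predOutput 0 0 δ l := by
  rw [predOutput, predState_eq, predInput_eq, nomOutput_apply, predOutput, Matrix.mulVec_add,
    Matrix.mulVec_add]
  abel

theorem continuous_predState (ξ : XiIdx m p τ → ℝ) (v : Fin L → Fin m → ℝ) (l : ℕ) :
    Continuous fun δ => S.predState ξ v δ l := by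
  induction l with
  | zero => exact continuous_const
  | succ l ih => unfold predState; fun_prop

theorem continuous_predInput (ξ : XiIdx m p τ → ℝ) (v : Fin L → Fin m → ℝ) (l : ℕ) :
    Continuous fun δ => S.predInput ξ v δ l := by
  have := S.continuous_predState ξ v l
  unfold predInput; fun_prop

theorem continuous_predOutput (ξ : XiIdx m p τ → ℝ) (v : Fin L → Fin m → ℝ) (l : ℕ) :
    Continuous fun δ => S.predOutput ξ v δ l := by
  have h1 := S.continuous_predState ξ v l
  have h2 := S.continuous_predInput ξ v l
  unfold predOutput; fun_prop

variable {S} {ν : ProbabilityMeasure (Fin p → ℝ)}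

theorem IsDisturbanceLaw.ae_forall_mem (hν : S.IsDisturbanceLaw ν) :
    ∀ᵐ δ ∂(Measure.infinitePi fun _ : ℕ => (ν : Measure (Fin p → ℝ))), ∀ k, δ k ∈ S.dset := by
  rw [ae_all_iff]
  intro k
  exact (measurePreserving_eval_infinitePi (fun _ : ℕ => (ν : Measure (Fin p → ℝ)))
    k).quasiMeasurePreserving.ae hν.1

theorem IsDisturbanceLaw.integrable_of_continuous (hν : S.IsDisturbanceLaw ν)
    (hD : IsCompact S.dset) {F : Type*} [NormedAddCommGroup F] [SecondCountableTopology F]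
    {f : (Fin p → ℝ) → F} (hf : Continuous f) : Integrable f (ν : Measure (Fin p → ℝ)) := by
  obtain ⟨C, hC⟩ := hD.exists_bound_of_continuousOn hf.continuousOn
  refine Integrable.of_bound hf.aestronglyMeasurable C ?_
  filter_upwards [hν.1] with d hd using hC d hd

/-- Almost every path lies in a product of compact sets, compact by Tychonoff, where a continuous
function is bounded. -/
theorem IsDisturbanceLaw.integrable_path_of_continuous (hν : S.IsDisturbanceLaw ν)
    (hD : IsCompact S.dset) {F : Type*} [NormedAddCommGroup F] [SecondCountableTopology F]
    {f : (ℕ → Fin p → ℝ) → F} (hf : Continuous f) :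
    Integrable f (Measure.infinitePi fun _ : ℕ => (ν : Measure (Fin p → ℝ))) := by
  obtain ⟨C, hC⟩ := (isCompact_univ_pi fun _ : ℕ => hD).exists_bound_of_continuousOn hf.continuousOn
  refine Integrable.of_bound hf.aestronglyMeasurable C ?_
  filter_upwards [hν.ae_forall_mem] with δ hδ using hC δ fun k _ => hδ k

theorem IsDisturbanceLaw.integral_coord_eq_zero (hν : S.IsDisturbanceLaw ν)
    (hD : IsCompact S.dset) (k : ℕ) :
    ∫ δ, δ k ∂(Measure.infinitePi fun _ : ℕ => (ν : Measure (Fin p → ℝ))) = 0 := by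
  have hmp := measurePreserving_eval_infinitePi (fun _ : ℕ => (ν : Measure (Fin p → ℝ))) k
  have h0 : ∫ d, d ∂(ν : Measure (Fin p → ℝ)) = 0 := by
    ext i
    rw [eval_integral fun i => hν.integrable_of_continuous hD (continuous_apply i)]
    exact hν.2 i
  have h1 := integral_map (μ := Measure.infinitePi fun _ : ℕ => (ν : Measure (Fin p → ℝ)))
    hmp.measurable.aemeasurable (f := fun d => d) (by fun_prop)
  rw [hmp.map_eq, h0] at h1
  exact h1.symm

theorem _root_.integral_linearMap_comp {Ω E F : Type*} [MeasurableSpace Ω] {P : Measure Ω}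
    [NormedAddCommGroup E] [NormedSpace ℝ E] [FiniteDimensional ℝ E] [CompleteSpace E]
    [NormedAddCommGroup F] [NormedSpace ℝ F] [CompleteSpace F]
    (T : E →ₗ[ℝ] F) {f : Ω → E} (hf : Integrable f P) : ∫ ω, T (f ω) ∂P = T (∫ ω, f ω ∂P) :=
  T.toContinuousLinearMap.integral_comp_comm hf

theorem _root_.integrable_linearMap_comp {Ω E F : Type*} [MeasurableSpace Ω] {P : Measure Ω}
    [NormedAddCommGroup E] [NormedSpace ℝ E] [FiniteDimensional ℝ E]
    [NormedAddCommGroup F] [NormedSpace ℝ F]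
    (T : E →ₗ[ℝ] F) {f : Ω → E} (hf : Integrable f P) : Integrable (fun ω => T (f ω)) P :=
  T.toContinuousLinearMap.integrable_comp hf

theorem IsDisturbanceLaw.integral_predState (hν : S.IsDisturbanceLaw ν)
    (hD : IsCompact S.dset) (l : ℕ) :
    ∫ δ, S.predState 0 0 δ l ∂(Measure.infinitePi fun _ : ℕ => (ν : Measure (Fin p → ℝ))) = 0 := by
  induction l with
  | zero => simp [predState]
  | succ l ih =>
    have e : ∀ δ, S.predState 0 0 δ (l + 1) =
        S.Acl.mulVecLin (S.predState 0 0 δ l) + S.E.mulVecLin (δ l) := fun δ => by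
      simp [predState, pad_zero, Acl]
    have i1 := hν.integrable_path_of_continuous hD (S.continuous_predState 0 0 l)
    have i2 := hν.integrable_path_of_continuous hD (continuous_apply l)
    simp_rw [e]
    rw [integral_add (integrable_linearMap_comp _ i1)
      (integrable_linearMap_comp _ i2), integral_linearMap_comp _ i1,
      integral_linearMap_comp _ i2, ih, hν.integral_coord_eq_zero hD, map_zero, map_zero, add_zero]

theorem IsDisturbanceLaw.integral_predInput (hν : S.IsDisturbanceLaw ν)
    (hD : IsCompact S.dset) (l : ℕ) :
    ∫ δ, S.predInput 0 0 δ l ∂(Measure.infinitePi fun _ : ℕ => (ν : Measure (Fin p → ℝ))) = 0 := by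
  have e : ∀ δ, S.predInput 0 0 δ l = S.K.mulVecLin (S.predState 0 0 δ l) := fun δ => by
    simp [predInput, pad_zero]
  simp_rw [e]
  rw [integral_linearMap_comp _
    (hν.integrable_path_of_continuous hD (S.continuous_predState 0 0 l)), hν.integral_predState hD, map_zero]

theorem IsDisturbanceLaw.integral_predOutput (hν : S.IsDisturbanceLaw ν)
    (hD : IsCompact S.dset) (l : ℕ) :
    ∫ δ, S.predOutput 0 0 δ l ∂(Measure.infinitePi fun _ : ℕ => (ν : Measure (Fin p → ℝ))) = 0 := by
  have e : ∀ δ, S.predOutput 0 0 δ l =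
      (S.Φ + S.Ψ * S.K).mulVecLin (S.predState 0 0 δ l) + δ l := fun δ => by
    simp [predOutput, predInput, pad_zero]
  have i1 := hν.integrable_path_of_continuous hD (S.continuous_predState 0 0 l)
  have i2 := hν.integrable_path_of_continuous hD (continuous_apply l)
  simp_rw [e]
  rw [integral_add (integrable_linearMap_comp _ i1) i2,
    integral_linearMap_comp _ i1, hν.integral_predState hD, hν.integral_coord_eq_zero hD, map_zero,
    add_zero]

/-- The mean of a weighted square splits into the square of the nominal part and the mean square of
a centered fluctuation. -/
theorem IsDisturbanceLaw.integral_wsq_add {ι : Type*} [Fintype ι] (hν : S.IsDisturbanceLaw ν)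
    (hD : IsCompact S.dset) (M : Matrix ι ι ℝ) (z : ι → ℝ) {f : (ℕ → Fin p → ℝ) → ι → ℝ}
    (hf : Continuous f)
    (hf0 : ∫ δ, f δ ∂(Measure.infinitePi fun _ : ℕ => (ν : Measure (Fin p → ℝ))) = 0) :
    ∫ δ, wsq M (z + f δ) ∂(Measure.infinitePi fun _ : ℕ => (ν : Measure (Fin p → ℝ))) =
      wsq M z + ∫ δ, wsq M (f δ) ∂(Measure.infinitePi fun _ : ℕ => (ν : Measure (Fin p → ℝ))) := by
  classical
  have e : ∀ δ, wsq M (z + f δ) = wsq M z + (wsq M (f δ) +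
      QuadraticMap.polarBilin (wsqForm M) z (f δ)) := fun δ => by
    simpa [add_assoc] using QuadraticForm.apply_add (wsqForm M) z (f δ)
  have i0 := hν.integrable_path_of_continuous hD hf
  have i1 : Integrable (fun δ => wsq M (f δ)) _ :=
    hν.integrable_path_of_continuous hD ((continuous_wsq M).comp hf)
  have i2 := integrable_linearMap_comp (QuadraticMap.polarBilin (wsqForm M) z) i0
  simp_rw [e]
  rw [integral_add (integrable_const _) (i1.fun_add i2), integral_add i1 i2,
    integral_linearMap_comp _ i0, hf0, map_zero, add_zero]
  simp

theorem IsDisturbanceLaw.integral_cost (hν : S.IsDisturbanceLaw ν) (hD : IsCompact S.dset)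
    (ξ : XiIdx m p τ → ℝ) (v : Fin L → Fin m → ℝ) :
    S.cost ν ξ v = ∑ l ∈ Finset.range L,
      (∫ δ, wsq S.Q (S.predOutput ξ v δ l)
          ∂(Measure.infinitePi fun _ : ℕ => (ν : Measure (Fin p → ℝ))) +
        ∫ δ, wsq S.R (S.predInput ξ v δ l)
          ∂(Measure.infinitePi fun _ : ℕ => (ν : Measure (Fin p → ℝ)))) +
      ∫ δ, wsq S.P (S.predState ξ v δ L)
          ∂(Measure.infinitePi fun _ : ℕ => (ν : Measure (Fin p → ℝ))) := by
  have i1 : ∀ l, Integrable (fun δ => wsq S.Q (S.predOutput ξ v δ l)) _ :=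
    fun l => hν.integrable_path_of_continuous hD
      ((continuous_wsq S.Q).comp (S.continuous_predOutput ξ v l))
  have i2 : ∀ l, Integrable (fun δ => wsq S.R (S.predInput ξ v δ l)) _ :=
    fun l => hν.integrable_path_of_continuous hD
      ((continuous_wsq S.R).comp (S.continuous_predInput ξ v l))
  have i3 : Integrable (fun δ => wsq S.P (S.predState ξ v δ L)) _ :=
    hν.integrable_path_of_continuous hD ((continuous_wsq S.P).comp (S.continuous_predState ξ v L))
  rw [cost, integral_add (integrable_finsetSum _ fun l _ => (i1 l).fun_add (i2 l)) i3,
    integral_finsetSum _ fun l _ => (i1 l).fun_add (i2 l)]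
  congr 1
  exact Finset.sum_congr rfl fun l _ => integral_add (i1 l) (i2 l)

/-- The expected cost is the nominal cost plus a constant. -/
theorem IsDisturbanceLaw.cost_eq (hν : S.IsDisturbanceLaw ν) (hD : IsCompact S.dset)
    (ξ : XiIdx m p τ → ℝ) (v : Fin L → Fin m → ℝ) :
    S.cost ν ξ v = S.nomCost (ξ, v) + S.cost ν 0 0 := by
  rw [hν.integral_cost hD, hν.integral_cost hD, nomCost_apply, add_add_add_comm,
    ← Finset.sum_add_distrib]
  congr 1
  · refine Finset.sum_congr rfl fun l _ => ?_
    simp_rw [predOutput_eq _ ξ, predInput_eq _ ξ]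
    rw [hν.integral_wsq_add hD _ _ (S.continuous_predOutput 0 0 l) (hν.integral_predOutput hD l),
      hν.integral_wsq_add hD _ _ (S.continuous_predInput 0 0 l) (hν.integral_predInput hD l)]
    ring
  · simp_rw [predState_eq _ ξ]
    rw [hν.integral_wsq_add hD _ _ (S.continuous_predState 0 0 L) (hν.integral_predState hD L)]

end DPC

/-! ### Measurability of a well-posed minimizer -/

/-- The projection of a closed set need not be closed, but here it is a countable union of compact
sets. -/
theorem IsClosed.measurableSet_image_fst {E F : Type*} [NormedAddCommGroup E] [ProperSpace E]
    [NormedAddCommGroup F] [ProperSpace F] [MeasurableSpace E] [BorelSpace E] {s : Set (E × F)}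
    (hs : IsClosed s) : MeasurableSet (Prod.fst '' s) := by
  have : Prod.fst '' s = ⋃ n : ℕ, Prod.fst '' (Metric.closedBall 0 (n : ℝ) ∩ s) := by
    rw [← Set.image_iUnion, ← Set.iUnion_inter, Metric.iUnion_closedBall_nat, Set.univ_inter]
  rw [this]
  exact MeasurableSet.iUnion fun n =>
    (((isCompact_closedBall _ _).inter_right hs).image continuous_fst).measurableSet

/-- A minimizer over the sections of a closed set is measurable in the parameter if the cost grows
quadratically away from it. -/
theorem measurable_indicator_of_growth {E F : Type*} [NormedAddCommGroup E] [ProperSpace E]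
    [NormedAddCommGroup F] [ProperSpace F] [MeasurableSpace E] [BorelSpace E]
    [MeasurableSpace F] [BorelSpace F] {X : Set E} (hX : IsClosed X) {G : Set (E × F)}
    (hG : IsClosed G) {J : E × F → ℝ} (hJ : Continuous J) {v : E → F}
    (hv : ∀ ξ ∈ X, (ξ, v ξ) ∈ G) {c : ℝ} (hc : 0 < c)
    (hgrowth : ∀ ξ ∈ X, ∀ w, (ξ, w) ∈ G → c * ‖w - v ξ‖ ^ 2 ≤ J (ξ, w) - J (ξ, v ξ)) :
    Measurable (X.indicator v) := by
  refine measurable_of_isClosed fun C hC => ?_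
  -- Parameters at which some admissible point of `C` has cost at most `r`.
  let Lv : Set F → ℚ → Set E := fun C r => Prod.fst '' (G ∩ (Prod.snd ⁻¹' C ∩ {x | J x ≤ r}))
  have hLv : ∀ C r, IsClosed C → MeasurableSet (Lv C r) := fun C r hC =>
    (hG.inter ((hC.preimage continuous_snd).inter
      (isClosed_le hJ continuous_const))).measurableSet_image_fst
  -- The minimizer lies in the closed set `C` exactly when `C` reaches every rational cost level
  -- that is attainable at all. Levels just above the minimum yield points of `C` that the growth
  -- condition forces close to the minimizer.
  have hset : X.indicator v ⁻¹' C =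
      (X ∩ ⋂ r : ℚ, ((Lv Set.univ r)ᶜ ∪ Lv C r)) ∪ (Xᶜ ∩ {_x | (0 : F) ∈ C}) := by
    ext ξ
    by_cases hξ : ξ ∈ X
    · simp only [Set.mem_preimage, Set.indicator_of_mem hξ, Set.mem_union, Set.mem_inter_iff, hξ,
        true_and, Set.mem_compl_iff, not_true_eq_false, false_and, or_false, Set.mem_iInter]
      constructor
      · intro hvC r
        by_cases h : ξ ∈ Lv Set.univ r
        · right
          obtain ⟨⟨ξ', w⟩, ⟨hwG, -, hwr⟩, rfl⟩ := h
          refine ⟨(ξ', v ξ'), ⟨hv ξ' hξ, hvC, ?_⟩, rfl⟩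
          have := hgrowth ξ' hξ w hwG
          have h0 : 0 ≤ c * ‖w - v ξ'‖ ^ 2 := by positivity
          simp only [Set.mem_ofPred_eq] at hwr ⊢
          linarith
        · exact Or.inl h
      · intro h
        rw [← hC.closure_eq, Metric.mem_closure_iff]
        intro e he
        obtain ⟨r, hr1, hr2⟩ := exists_rat_btwn
          (show J (ξ, v ξ) < J (ξ, v ξ) + c * e ^ 2 by nlinarith [mul_pos hc (pow_pos he 2)])
        have hmem : ξ ∈ Lv Set.univ r := ⟨(ξ, v ξ), ⟨hv ξ hξ, trivial, hr1.le⟩, rfl⟩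
        obtain ⟨⟨ξ', w⟩, ⟨hwG, hwC, hwr⟩, rfl⟩ := (h r).resolve_left fun h => h hmem
        refine ⟨w, hwC, ?_⟩
        have h1 := hgrowth ξ' hξ w hwG
        have h2 : c * ‖w - v ξ'‖ ^ 2 < c * e ^ 2 := by
          simp only [Set.mem_ofPred_eq] at hwr
          linarith
        rw [dist_comm, dist_eq_norm]
        exact lt_of_pow_lt_pow_left₀ 2 he.le (lt_of_mul_lt_mul_left h2 hc.le)
    · simp [hξ]
  rw [hset]
  refine (hX.measurableSet.inter (MeasurableSet.iInter fun r =>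
    (hLv _ r isClosed_univ).compl.union (hLv C r hC))).union
    (hX.measurableSet.compl.inter (MeasurableSet.const _))

namespace DPC

variable {m p τ L Nv nD nC nX : ℕ} (S : DPC m p τ L Nv nD nC nX)

/-! ### The feasible set -/

/-- Pairs of an extended state and feasible correction inputs. -/
def feasiblePairs : Set (Dec m p τ L) := {x | x.2 ∈ S.feasible x.1}

/-- `col(ξ, v)` as a linear map. -/
def colLin (m p τ L : ℕ) : Dec m p τ L →ₗ[ℝ] XiIdx m p τ ⊕ (Fin L × Fin m) → ℝ where
  toFun x := Sum.elim x.1 fun q => x.2 q.1 q.2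
  map_add' x y := by ext (i | i) <;> rfl
  map_smul' c x := by ext (i | i) <;> rfl

theorem feasiblePairs_eq : S.feasiblePairs = colLin m p τ L ⁻¹' polyhedron S.GC S.gC ∩
    ⋂ d ∈ S.dset, ⋂ j, ((S.Aclv j).mulVecLin ∘ₗ LinearMap.fst ℝ _ _ +
      (S.Bv j).mulVecLin ∘ₗ padLin m L 0 ∘ₗ LinearMap.snd ℝ _ _ :
        Dec m p τ L →ₗ[ℝ] XiIdx m p τ → ℝ) ⁻¹'
        ((fun z => z + S.E.mulVec d) ⁻¹' S.roa) := by
  ext x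
  simp only [Set.mem_inter_iff, Set.mem_iInter]
  rfl

theorem isClosed_feasiblePairs : IsClosed S.feasiblePairs := by
  rw [feasiblePairs_eq]
  refine ((isClosed_polyhedron _ _).preimage (LinearMap.continuous_of_finiteDimensional _)).inter
    (isClosed_biInter fun d _ => isClosed_iInter fun j => ?_)
  exact (S.isClosed_roa.preimage (continuous_id.add continuous_const)).preimage
    (LinearMap.continuous_of_finiteDimensional _)

theorem convex_feasiblePairs : Convex ℝ S.feasiblePairs := by
  rw [feasiblePairs_eq]
  refine ((convex_polyhedron _ _).linear_preimage _).inter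
    (convex_iInter₂ fun d _ => convex_iInter fun j => ?_)
  exact (S.convex_roa.translate_preimage_left _).linear_preimage _

/-! ### Properties of the nominal cost -/

variable {S}

theorem nomCost_nonneg (hQ : S.Q.PosDef) (hR : S.R.PosDef) (hP : S.P.PosDef)
    (x : Dec m p τ L) : 0 ≤ S.nomCost x := by
  rw [nomCost_apply]
  exact add_nonneg (Finset.sum_nonneg fun l _ => add_nonneg (wsq_nonneg hQ.posSemidef _)
    (wsq_nonneg hR.posSemidef _)) (wsq_nonneg hP.posSemidef _)

/-- Zero cost makes all inputs vanish since `R` is definite. From the zero state the prediction then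
stays at zero, so inputs and corrections coincide. -/
theorem eq_zero_of_nomCost_eq_zero (hQ : S.Q.PosDef) (hR : S.R.PosDef) (hP : S.P.PosDef)
    {x : Dec m p τ L} (h1 : x.1 = 0) (h : S.nomCost x = 0) : x = 0 := by
  rw [nomCost_apply] at h
  have hterm : ∀ l ∈ Finset.range L,
      0 ≤ wsq S.Q (S.nomOutput l x) + wsq S.R (S.nomInput l x) := fun l _ =>
    add_nonneg (wsq_nonneg hQ.posSemidef _) (wsq_nonneg hR.posSemidef _)
  have hsum := ((add_eq_zero_iff_of_nonneg (Finset.sum_nonneg hterm)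
    (wsq_nonneg hP.posSemidef _)).1 h).1
  have hin : ∀ l < L, S.nomInput l x = 0 := fun l hl => by
    have := (Finset.sum_eq_zero_iff_of_nonneg hterm).1 hsum l (Finset.mem_range.2 hl)
    exact eq_zero_of_wsq_eq_zero hR ((add_eq_zero_iff_of_nonneg (wsq_nonneg hQ.posSemidef _)
      (wsq_nonneg hR.posSemidef _)).1 this).2
  have hst : ∀ l ≤ L, S.nomState l x = 0 := by
    intro l
    induction l with
    | zero => exact fun _ => h1
    | succ l ih =>
      intro hl
      rw [nomState_succ', ih (by omega), hin l (by omega), Matrix.mulVec_zero, Matrix.mulVec_zero,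
        add_zero]
  refine Prod.ext h1 (funext fun l => ?_)
  have h2 := hin l l.2
  rw [nomInput_apply, hst l l.2.le, Matrix.mulVec_zero, zero_add, pad, dif_pos l.2] at h2
  exact h2

theorem exists_norm_sq_le_nomCost_add (hQ : S.Q.PosDef) (hR : S.R.PosDef) (hP : S.P.PosDef) :
    ∃ c, 0 < c ∧ ∀ x : Dec m p τ L, c * ‖x‖ ^ 2 ≤ S.nomCost x + euclNorm x.1 ^ 2 := by
  obtain ⟨c, hc, h⟩ := QuadraticForm.exists_le_of_posDef
    (S.nomCost + (wsqForm 1).comp (LinearMap.fst ℝ _ _)) (fun x hx => by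
      have h1 := nomCost_nonneg hQ hR hP x
      have h2 : 0 ≤ euclNorm x.1 ^ 2 := sq_nonneg _
      simp only [add_apply, QuadraticMap.comp_apply, LinearMap.fst_apply,
        wsqForm_apply, wsq_one]
      rcases h2.eq_or_lt with h0 | h0
      · refine add_pos_of_pos_of_nonneg (h1.lt_of_ne fun h => hx ?_) h2
        refine eq_zero_of_nomCost_eq_zero hQ hR hP ?_ h.symm
        rw [← wsq_one] at h0
        exact eq_zero_of_wsq_eq_zero Matrix.PosDef.one h0.symm
      · exact add_pos_of_nonneg_of_pos h1 h0)
  refine ⟨c, hc, fun x => ?_⟩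
  simpa [wsq_one] using h x

/-! ### Optimal correction inputs -/

variable {vstar : (XiIdx m p τ → ℝ) → Fin L → Fin m → ℝ}

variable (S) in
/-- `vstar` minimizes the nominal cost over the feasible correction inputs. -/
def IsNomOptimal (vstar : (XiIdx m p τ → ℝ) → Fin L → Fin m → ℝ) : Prop :=
  ∀ ξ ∈ S.roa, vstar ξ ∈ S.feasible ξ ∧
    ∀ v ∈ S.feasible ξ, S.nomCost (ξ, vstar ξ) ≤ S.nomCost (ξ, v)

/-- From here on the distribution no longer enters the controller, so one feedback can be analyzed
under all admissible laws. -/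
theorem IsOptimal.isNomOptimal {μ : ProbabilityMeasure (Fin p → ℝ)} (h : S.IsOptimal μ vstar)
    (hμ : S.IsDisturbanceLaw μ) (hD : IsCompact S.dset) : S.IsNomOptimal vstar := fun ξ hξ =>
  ⟨(h ξ hξ).1, fun v hv => by
    have := (h ξ hξ).2 v hv
    rw [hμ.cost_eq hD, hμ.cost_eq hD ξ v] at this
    linarith⟩

theorem IsOptimal.optCost_eq {μ : ProbabilityMeasure (Fin p → ℝ)} (h : S.IsOptimal μ vstar)
    {ξ : XiIdx m p τ → ℝ} (hξ : ξ ∈ S.roa) : S.optCost μ ξ = S.cost μ ξ (vstar ξ) :=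
  IsLeast.csInf_eq ⟨⟨_, (h ξ hξ).1, rfl⟩, by rintro _ ⟨v, hv, rfl⟩; exact (h ξ hξ).2 v hv⟩

/-- The optimal nominal cost, normalized to vanish at the origin. -/
noncomputable def value (S : DPC m p τ L Nv nD nC nX)
    (vstar : (XiIdx m p τ → ℝ) → Fin L → Fin m → ℝ) (ξ : XiIdx m p τ → ℝ) : ℝ :=
  S.nomCost (ξ, vstar ξ) - S.nomCost (0, vstar 0)

/-- Both quadratic bounds vanish at the origin, which identifies `c` as the optimal cost there. -/
theorem CostBounded.value_bounds {μ : ProbabilityMeasure (Fin p → ℝ)}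
    {Pl Pu : Matrix (XiIdx m p τ) (XiIdx m p τ) ℝ} (h : S.CostBounded μ Pl Pu)
    (hopt : S.IsOptimal μ vstar) (hμ : S.IsDisturbanceLaw μ) (hD : IsCompact S.dset)
    (h0 : (0 : XiIdx m p τ → ℝ) ∈ S.roa) {ξ : XiIdx m p τ → ℝ} (hξ : ξ ∈ S.roa) :
    wsq Pl ξ ≤ S.value vstar ξ ∧ S.value vstar ξ ≤ wsq Pu ξ := by
  obtain ⟨c, hc⟩ := h
  have e1 := hc ξ hξ
  have e2 := hc 0 h0
  rw [hopt.optCost_eq hξ, hμ.cost_eq hD] at e1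
  rw [hopt.optCost_eq h0, hμ.cost_eq hD 0 (vstar 0), wsq_zero, wsq_zero] at e2
  rw [value]
  constructor <;> linarith [e1.1, e1.2, e2.1, e2.2]

/-- The midpoint of two feasible decisions is feasible, so it costs at least the minimum; the
parallelogram identity converts this into growth. -/
theorem IsNomOptimal.growth (h : S.IsNomOptimal vstar) {ξ : XiIdx m p τ → ℝ} (hξ : ξ ∈ S.roa)
    {v : Fin L → Fin m → ℝ} (hv : v ∈ S.feasible ξ) :
    S.nomCost (0, v - vstar ξ) ≤ 2 * (S.nomCost (ξ, v) - S.nomCost (ξ, vstar ξ)) := by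
  have hmid : (1 / 2 : ℝ) • (ξ, v) + (1 / 2 : ℝ) • (ξ, vstar ξ) ∈ S.feasiblePairs :=
    S.convex_feasiblePairs (x := (ξ, v)) hv (y := (ξ, vstar ξ)) (h ξ hξ).1 (by norm_num)
      (by norm_num) (by norm_num)
  have hfst : ((1 / 2 : ℝ) • (ξ, v) + (1 / 2 : ℝ) • (ξ, vstar ξ)).1 = ξ := by
    simp only [Prod.fst_add, Prod.smul_fst, ← add_smul]
    norm_num
  have h1 := (h ξ hξ).2 _ (by rw [← hfst]; exact hmid)
  have e : (ξ, ((1 / 2 : ℝ) • (ξ, v) + (1 / 2 : ℝ) • (ξ, vstar ξ)).2) =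
      (1 / 2 : ℝ) • ((ξ, v) + (ξ, vstar ξ)) := by
    rw [smul_add]; exact Prod.ext hfst.symm rfl
  rw [e, QuadraticMap.map_smul, smul_eq_mul] at h1
  have h2 := QuadraticForm.apply_add_add_apply_sub S.nomCost (ξ, v) (ξ, vstar ξ)
  rw [Prod.mk_sub_mk, sub_self] at h2
  linarith

theorem IsNomOptimal.measurable_indicator (h : S.IsNomOptimal vstar) (hQ : S.Q.PosDef)
    (hR : S.R.PosDef) (hP : S.P.PosDef) : Measurable (S.roa.indicator vstar) := by
  obtain ⟨c, hc, hle⟩ := exists_norm_sq_le_nomCost_add hQ hR hP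
  refine measurable_indicator_of_growth S.isClosed_roa S.isClosed_feasiblePairs
    (QuadraticForm.continuous_of_finiteDimensional S.nomCost) (fun ξ hξ => (h ξ hξ).1)
    (half_pos hc) fun ξ hξ w hw => ?_
  have h1 := h.growth hξ hw
  have h2 := hle (0, w - vstar ξ)
  have h3 : ‖((0 : XiIdx m p τ → ℝ), w - vstar ξ)‖ = ‖w - vstar ξ‖ := by simp [Prod.norm_def]
  have h4 : euclNorm (0 : XiIdx m p τ → ℝ) = 0 := by simp [euclNorm]
  rw [h3] at h2
  simp only [h4] at h2
  linarith

/-! ### The shifted candidate -/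

/-- The undisturbed successor state together with the shifted correction inputs. -/
noncomputable def shiftLin (S : DPC m p τ L Nv nD nC nX) : Dec m p τ L →ₗ[ℝ] Dec m p τ L :=
  (S.nomState 1).prod (LinearMap.pi fun l : Fin L => padLin m L (l + 1) ∘ₗ LinearMap.snd ℝ _ _)

/-- The effect of the disturbance on successor state and candidate. -/
noncomputable def distLin (S : DPC m p τ L Nv nD nC nX) : (Fin p → ℝ) →ₗ[ℝ] Dec m p τ L :=
  S.E.mulVecLin.prod (LinearMap.pi fun l : Fin L => (S.K * S.Acl ^ (l : ℕ) * S.E).mulVecLin)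

theorem closedLoop_eq (ξ : XiIdx m p τ → ℝ) (d : Fin p → ℝ) : S.closedLoop vstar ξ d =
    S.nomState 1 (ξ, vstar ξ) + S.E.mulVec d := by
  rw [nomState_succ']; rfl

theorem candidate_pair_eq (ξ : XiIdx m p τ → ℝ) (d : Fin p → ℝ) :
    (S.closedLoop vstar ξ d, S.candidate (vstar ξ) d) =
      S.shiftLin (ξ, vstar ξ) + S.distLin d := by
  rw [closedLoop_eq]; rfl

theorem candidate_mem_feasible_iff (ξ : XiIdx m p τ → ℝ) (d : Fin p → ℝ) :
    S.candidate (vstar ξ) d ∈ S.feasible (S.closedLoop vstar ξ d) ↔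
      S.shiftLin (ξ, vstar ξ) + S.distLin d ∈ S.feasiblePairs := by
  rw [← candidate_pair_eq]; rfl

theorem isClosed_candidate_feasible (ξ : XiIdx m p τ → ℝ) :
    IsClosed {d | S.candidate (vstar ξ) d ∈ S.feasible (S.closedLoop vstar ξ d)} := by
  simp_rw [candidate_mem_feasible_iff]
  exact S.isClosed_feasiblePairs.preimage
    (continuous_const.add (LinearMap.continuous_of_finiteDimensional _))

theorem pad_shiftLin (x : Dec m p τ L) (l : ℕ) : pad (S.shiftLin x).2 l = pad x.2 (l + 1) := by
  by_cases h : l < L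
  · rw [pad, dif_pos h]; rfl
  · rw [pad, dif_neg h, pad, dif_neg (by omega)]

theorem nomState_shiftLin (x : Dec m p τ L) (l : ℕ) :
    S.nomState l (S.shiftLin x) = S.nomState (l + 1) x := by
  induction l with
  | zero => rfl
  | succ l ih => rw [nomState_succ, ih, pad_shiftLin, ← nomState_succ]

theorem nomInput_shiftLin (x : Dec m p τ L) (l : ℕ) :
    S.nomInput l (S.shiftLin x) = S.nomInput (l + 1) x := by
  rw [nomInput_apply, nomState_shiftLin, pad_shiftLin, ← nomInput_apply]

theorem nomOutput_shiftLin (x : Dec m p τ L) (l : ℕ) :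
    S.nomOutput l (S.shiftLin x) = S.nomOutput (l + 1) x := by
  rw [nomOutput_apply, nomState_shiftLin, nomInput_shiftLin, ← nomOutput_apply]

/-- Shifting drops stage `0` and appends stage `L`, at which the correction is zero and the input is
pure state feedback. The terminal decrease pays for the appended stage. -/
theorem IsVertexWeights.nomCost_shiftLin_le {w : Fin Nv → ℝ} (hw : S.IsVertexWeights w)
    (hτ : 0 < τ) (hQ : S.Q.PosDef) (hP : S.P.PosDef) (hterm : S.TerminalDecrease)
    (x : Dec m p τ L) : S.nomCost (S.shiftLin x) ≤
      S.nomCost x - (wsq S.Q (S.nomOutput 0 x) + wsq S.R (S.nomInput 0 x)) := by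
  have h := hw.terminal_decrease hτ hQ hP hterm (S.nomState L x)
  have hpad : pad x.2 L = 0 := by simp [pad]
  have hin : S.nomInput L x = S.K.mulVec (S.nomState L x) := by rw [nomInput_apply, hpad, add_zero]
  have hst : S.nomState (L + 1) x = S.Acl.mulVec (S.nomState L x) := by
    rw [nomState_succ, hpad, Matrix.mulVec_zero, add_zero]
  rw [← hin, ← nomOutput_apply, ← hst] at h
  rw [nomCost_apply, nomCost_apply]
  simp_rw [nomState_shiftLin, nomInput_shiftLin, nomOutput_shiftLin]
  have e1 := Finset.sum_range_succ
    (fun l => wsq S.Q (S.nomOutput l x) + wsq S.R (S.nomInput l x)) L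
  have e2 := Finset.sum_range_succ'
    (fun l => wsq S.Q (S.nomOutput l x) + wsq S.R (S.nomInput l x)) L
  linarith

/-! ### The optimal cost at the origin -/

theorem trace_covMatrix {ν : ProbabilityMeasure (Fin p → ℝ)} (hν : S.IsDisturbanceLaw ν)
    (hD : IsCompact S.dset) :
    (covMatrix ν).trace = ∫ d, euclNorm d ^ 2 ∂(ν : Measure (Fin p → ℝ)) := by
  simp only [Matrix.trace, Matrix.diag_apply, covMatrix, Matrix.of_apply, euclNorm_sq, dotProduct]
  rw [integral_finsetSum]
  exact fun i _ => hν.integrable_of_continuous hD (by fun_prop)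

theorem trace_covMatrix_nonneg {ν : ProbabilityMeasure (Fin p → ℝ)} (hν : S.IsDisturbanceLaw ν)
    (hD : IsCompact S.dset) : 0 ≤ (covMatrix ν).trace := by
  rw [trace_covMatrix hν hD]
  exact integral_nonneg fun d => sq_nonneg _

theorem _root_.norm_sq_le_euclNorm_sq {ι : Type*} [Fintype ι] (x : ι → ℝ) :
    ‖x‖ ^ 2 ≤ euclNorm x ^ 2 := by
  refine pow_le_pow_left₀ (norm_nonneg _) ?_ 2
  rw [pi_norm_le_iff_of_nonneg (euclNorm_nonneg x)]
  exact fun i => PiLp.norm_apply_le (WithLp.toLp 2 x : EuclideanSpace ℝ ι) i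

/-- If the undisturbed candidate is feasible at the origin, then no control is applied there. -/
theorem IsNomOptimal.nomCost_zero_eq_zero (h : S.IsNomOptimal vstar) {w : Fin Nv → ℝ}
    (hw : S.IsVertexWeights w) (hτ : 0 < τ) (hQ : S.Q.PosDef) (hR : S.R.PosDef) (hP : S.P.PosDef)
    (hterm : S.TerminalDecrease) (h0 : (0 : XiIdx m p τ → ℝ) ∈ S.roa)
    (hroa : S.nomState 1 (0, vstar 0) ∈ S.roa) (hval : ∀ ξ ∈ S.roa, 0 ≤ S.value vstar ξ)
    (hfeas : S.shiftLin (0, vstar 0) ∈ S.feasiblePairs) : S.nomCost (0, vstar 0) = 0 := by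
  set x : Dec m p τ L := (0, vstar 0) with hx
  have h1 := hw.nomCost_shiftLin_le hτ hQ hP hterm x
  have h2 : S.nomCost (S.nomState 1 x, vstar (S.nomState 1 x)) ≤ S.nomCost (S.shiftLin x) :=
    (h _ hroa).2 (S.shiftLin x).2 hfeas
  have h3 := hval _ hroa
  rw [value, ← hx] at h3
  have h4 := wsq_nonneg hQ.posSemidef (S.nomOutput 0 x)
  have h5 := wsq_nonneg hR.posSemidef (S.nomInput 0 x)
  -- The value is nonnegative at the successor, so nothing is left to pay for the first stage: its
  -- cost vanishes and the successor is again the origin.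
  have hin : S.nomInput 0 x = 0 := eq_zero_of_wsq_eq_zero hR (by linarith)
  have hst : S.nomState 1 x = 0 := by
    rw [nomState_succ', hin, nomState_zero, hx]
    simp
  have hsh : S.shiftLin x = (0, (S.shiftLin x).2) := Prod.ext hst rfl
  have hgr := h.growth h0 (v := (S.shiftLin x).2) (by rw [hsh] at hfeas; exact hfeas)
  rw [← hsh, ← hx] at hgr
  have hdiff := eq_zero_of_nomCost_eq_zero hQ hR hP (x := (0, (S.shiftLin x).2 - vstar 0)) rfl
    (le_antisymm (by linarith) (nomCost_nonneg hQ hR hP _))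
  have heq : (S.shiftLin x).2 = vstar 0 := sub_eq_zero.1 (congrArg Prod.snd hdiff)
  -- The shifted sequence is also optimal at the origin, and the optimum is unique. The corrections
  -- are therefore shift invariant; the first one is zero, hence so are all.
  have hpad : ∀ l, pad (vstar 0) (l + 1) = pad (vstar 0) l := fun l => by
    rw [← pad_shiftLin (S := S) x l, heq]
  have hp0 : pad (vstar 0) 0 = 0 := by
    have := hin
    rw [nomInput_apply, nomState_zero, hx, Matrix.mulVec_zero, zero_add] at this
    exact this
  have hall : ∀ l, pad (vstar 0) l = 0 := fun l => by
    induction l with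
    | zero => exact hp0
    | succ l ih => rw [hpad, ih]
  have hv0 : vstar 0 = 0 := funext fun l => by
    have := hall l
    rwa [pad, dif_pos l.2] at this
  rw [hx, hv0]
  exact map_zero S.nomCost

/-- The optimal nominal cost at the origin is bounded by the total variance, uniformly over the
admissible laws. -/
theorem IsNomOptimal.exists_nomCost_zero_le (h : S.IsNomOptimal vstar) (hD : IsCompact S.dset)
    (hD0 : (0 : Fin p → ℝ) ∈ S.dset) {w : Fin Nv → ℝ}
    (hw : S.IsVertexWeights w) (hτ : 0 < τ) (hQ : S.Q.PosDef) (hR : S.R.PosDef) (hP : S.P.PosDef)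
    (hterm : S.TerminalDecrease) (h0 : (0 : XiIdx m p τ → ℝ) ∈ S.roa)
    (hval : ∀ ξ ∈ S.roa, 0 ≤ S.value vstar ξ) {ε : ℝ} (hε : ε < 1) :
    ∃ C, 0 ≤ C ∧ ∀ ν, S.IsDisturbanceLaw ν → S.CandidateInfeasibleLE ν vstar ε →
      S.nomCost (0, vstar 0) ≤ C * (covMatrix ν).trace := by
  by_cases hfeas : S.shiftLin (0, vstar 0) ∈ S.feasiblePairs
  · have hroa : S.nomState 1 (0, vstar 0) ∈ S.roa := by
      have := hw.mem_roa (h 0 h0).1.2 hD0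
      rw [Matrix.mulVec_zero S.E, add_zero] at this
      exact this
    refine ⟨0, le_rfl, fun ν _ _ => ?_⟩
    rw [h.nomCost_zero_eq_zero hw hτ hQ hR hP hterm h0 hroa hval hfeas, zero_mul]
  -- Infeasibility without disturbance persists on a ball around zero. An admissible law gives this
  -- ball mass at most `ε`, so Markov's inequality yields `tr Σ ≥ r ^ 2 * (1 - ε)`.
  · have hopen : IsOpen {d | S.candidate (vstar 0) d ∉ S.feasible (S.closedLoop vstar 0 d)} :=
      (isClosed_candidate_feasible (S := S) (vstar := vstar) 0).isOpen_compl
    have h0mem : (0 : Fin p → ℝ) ∈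
        {d | S.candidate (vstar 0) d ∉ S.feasible (S.closedLoop vstar 0 d)} := by
      simpa [candidate_mem_feasible_iff] using hfeas
    obtain ⟨r, hr, hball⟩ := Metric.isOpen_iff.1 hopen 0 h0mem
    have hc0 := nomCost_nonneg hQ hR hP ((0 : XiIdx m p τ → ℝ), vstar 0)
    have hs : 0 < r ^ 2 * (1 - ε) := mul_pos (pow_pos hr 2) (sub_pos.2 hε)
    refine ⟨S.nomCost (0, vstar 0) / (r ^ 2 * (1 - ε)), by positivity, fun ν hν hcand => ?_⟩
    have hmeas : (ν : Measure (Fin p → ℝ)).real (Metric.ball 0 r) ≤ ε :=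
      (measureReal_mono hball).trans (hcand 0 h0)
    have hcompl : 1 - ε ≤ (ν : Measure (Fin p → ℝ)).real (Metric.ball 0 r)ᶜ := by
      rw [probReal_compl_eq_one_sub Metric.isOpen_ball.measurableSet]
      linarith
    have hmarkov : r ^ 2 * (ν : Measure (Fin p → ℝ)).real {d | r ^ 2 ≤ euclNorm d ^ 2} ≤
        ∫ d, euclNorm d ^ 2 ∂(ν : Measure (Fin p → ℝ)) :=
      mul_meas_ge_le_integral_of_nonneg (ae_of_all _ fun d => sq_nonneg _)
        (hν.integrable_of_continuous hD (continuous_euclNorm.pow 2)) _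
    have hsub : (Metric.ball (0 : Fin p → ℝ) r)ᶜ ⊆ {d | r ^ 2 ≤ euclNorm d ^ 2} := fun d hd => by
      have hd' : r ≤ ‖d‖ := by simpa using hd
      exact (pow_le_pow_left₀ hr.le hd' 2).trans (norm_sq_le_euclNorm_sq d)
    have hfin : r ^ 2 * (1 - ε) ≤ (covMatrix ν).trace := by
      rw [trace_covMatrix hν hD]
      refine le_trans ?_ hmarkov
      gcongr
      exact hcompl.trans (measureReal_mono hsub)
    rw [div_mul_eq_mul_div, le_div_iff₀ hs]
    gcongr

end DPC

/-! ### Comparison of weighted squares with the Euclidean norm -/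

theorem exists_euclNorm_sq_le (ι : Type*) [Fintype ι] :
    ∃ C, 0 < C ∧ ∀ x : ι → ℝ, euclNorm x ^ 2 ≤ C * ‖x‖ ^ 2 := by
  classical
  obtain ⟨C, hC, h⟩ := QuadraticForm.exists_abs_le (wsqForm (1 : Matrix ι ι ℝ))
  refine ⟨C + 1, by positivity, fun x => ?_⟩
  have := (le_abs_self _).trans (h x)
  rw [wsqForm_apply, wsq_one] at this
  nlinarith [sq_nonneg ‖x‖]

theorem wsq_fromBlocks {ι κ : Type*} [Fintype ι] [Fintype κ] (M₁₁ : Matrix ι ι ℝ)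
    (M₁₂ : Matrix ι κ ℝ) (M₂₁ : Matrix κ ι ℝ) (M₂₂ : Matrix κ κ ℝ) (x : ι → ℝ) (u : κ → ℝ) :
    wsq (Matrix.fromBlocks M₁₁ M₁₂ M₂₁ M₂₂) (Sum.elim x u) =
      wsq M₁₁ x + x ⬝ᵥ M₁₂.mulVec u + u ⬝ᵥ M₂₁.mulVec x + wsq M₂₂ u := by
  rw [wsq, Matrix.fromBlocks_mulVec, sumElim_dotProduct_sumElim]
  simp only [Sum.elim_comp_inl, Sum.elim_comp_inr, dotProduct_add, wsq]
  ring

theorem exists_mul_euclNorm_sq_le_wsq {ι : Type*} [Fintype ι] {M : Matrix ι ι ℝ} (hM : M.PosDef) :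
    ∃ c, 0 < c ∧ ∀ x, c * euclNorm x ^ 2 ≤ wsq M x := by
  classical
  obtain ⟨c, hc, h⟩ := QuadraticForm.exists_le_of_posDef _ (wsqForm_posDef hM)
  obtain ⟨C, hC, hN⟩ := exists_euclNorm_sq_le ι
  refine ⟨c / C, by positivity, fun x => ?_⟩
  calc c / C * euclNorm x ^ 2 ≤ c / C * (C * ‖x‖ ^ 2) := by gcongr; exact hN x
    _ = c * ‖x‖ ^ 2 := by field_simp
    _ ≤ wsq M x := by simpa using h x

theorem exists_wsq_le {ι : Type*} [Fintype ι] (M : Matrix ι ι ℝ) :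
    ∃ C, 0 < C ∧ ∀ x, wsq M x ≤ C * euclNorm x ^ 2 := by
  classical
  obtain ⟨C, hC, h⟩ := QuadraticForm.exists_abs_le (wsqForm M)
  refine ⟨C + 1, by positivity, fun x => ?_⟩
  have h1 := (le_abs_self _).trans (h x)
  rw [wsqForm_apply] at h1
  nlinarith [norm_sq_le_euclNorm_sq x, sq_nonneg (euclNorm x)]

namespace DPC

variable {m p τ L Nv nD nC nX : ℕ} {S : DPC m p τ L Nv nD nC nX}
  {vstar : (XiIdx m p τ → ℝ) → Fin L → Fin m → ℝ}
  {Pl Pu PW : Matrix (XiIdx m p τ) (XiIdx m p τ) ℝ} {cu cy cd ε : ℝ}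

/-! ### Drift of the Lyapunov function -/

theorem wsq_QS (ξ : XiIdx m p τ → ℝ) (u : Fin m → ℝ) :
    wsq (S.QS Pl Pu cu cy ε S.A S.B) (Sum.elim ξ u) =
      S.cS cu cy / 2 * euclNorm ξ ^ 2 + wsq S.R u - S.cS cu cy * cu * euclNorm u ^ 2 -
        ε / (1 - ε) * (wsq Pu (S.A.mulVec ξ + S.B.mulVec u) - wsq Pl ξ) := by
  have hb : wsq Pu (S.A.mulVec ξ + S.B.mulVec u) =
      wsq (S.A.transpose * Pu * S.A) ξ + ξ ⬝ᵥ (S.A.transpose * Pu * S.B).mulVec u +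
        u ⬝ᵥ (S.B.transpose * Pu * S.A).mulVec ξ + wsq (S.B.transpose * Pu * S.B) u := by
    rw [wsq_transpose_mul_mul, wsq_transpose_mul_mul]
    simp only [wsq, ← Matrix.mulVec_mulVec, Matrix.dotProduct_mulVec _ (Matrix.transpose _),
      Matrix.vecMul_transpose, Matrix.mulVec_add, dotProduct_add, add_dotProduct]
    ring
  rw [QS, wsq_sub, wsq_smul, wsq_fromBlocks, wsq_fromBlocks, wsq_smul, wsq_sub, wsq_sub, wsq_smul,
    wsq_one, wsq_one, hb, Matrix.zero_mulVec, Matrix.zero_mulVec, dotProduct_zero, dotProduct_zero]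
  ring

theorem cS_pos (hm : 0 < m) (hp : 0 < p) (hQ : S.Q.PosDef) (hR : S.R.PosDef) (hcu : 0 < cu) :
    0 < S.cS cu cy := by
  have : Nonempty (Fin m) := ⟨⟨0, hm⟩⟩
  have : Nonempty (Fin p) := ⟨⟨0, hp⟩⟩
  exact div_pos (lt_min (evMin_pos hQ) (evMin_pos hR)) (lt_max_of_lt_left hcu)

/-- This is the purpose of `cS`: after scaling by it, the input and output terms of the
detectability inequality are dominated by the stage cost. -/
theorem cS_mul_le (hm : 0 < m) (hp : 0 < p) (hQ : S.Q.PosDef) (hR : S.R.PosDef) (hcu : 0 < cu)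
    (y : Fin p → ℝ) (u : Fin m → ℝ) :
    S.cS cu cy * cy * euclNorm y ^ 2 ≤ wsq S.Q y ∧
      S.cS cu cy * cu * euclNorm u ^ 2 ≤ wsq S.R u := by
  have hmax : 0 < max cu cy := lt_max_of_lt_left hcu
  have hcS := (cS_pos (S := S) (cy := cy) hm hp hQ hR hcu).le
  have he : S.cS cu cy * max cu cy = min (evMin S.Q) (evMin S.R) := by
    rw [cS, div_mul_cancel₀ _ hmax.ne']
  constructor
  · refine le_trans ?_ (evMin_mul_le hQ.1 y)
    gcongr
    calc S.cS cu cy * cy ≤ S.cS cu cy * max cu cy := by gcongr; exact le_max_right _ _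
      _ ≤ _ := by rw [he]; exact min_le_left _ _
  · refine le_trans ?_ (evMin_mul_le hR.1 u)
    gcongr
    calc S.cS cu cy * cu ≤ S.cS cu cy * max cu cy := by gcongr; exact le_max_left _ _
      _ ≤ _ := by rw [he]; exact min_le_right _ _

/-- Decrease of the nominal part of the Lyapunov function, for any probability `π ≤ ε` that the
candidate is infeasible. -/
theorem exists_nominal_decrease (hm : 0 < m) (hp : 0 < p) (hQ : S.Q.PosDef) (hR : S.R.PosDef)
    (hcu : 0 < cu) (hε0 : 0 ≤ ε) (hε : ε < 1)
    (hQS : (S.QS Pl Pu cu cy ε S.A S.B).PosDef)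
    (hval : ∀ ξ ∈ S.roa, wsq Pl ξ ≤ S.value vstar ξ) :
    ∃ η, 0 < η ∧ ∀ ξ ∈ S.roa, ∀ π, 0 ≤ π → π ≤ ε →
      (1 - π) * (S.value vstar ξ - (wsq S.Q (S.nomOutput 0 (ξ, vstar ξ)) +
          wsq S.R (S.nomInput 0 (ξ, vstar ξ)))) + π * wsq Pu (S.nomState 1 (ξ, vstar ξ)) +
        (1 - ε) * S.cS cu cy * (-(1 / 2) * euclNorm ξ ^ 2 +
          cu * euclNorm (S.nomInput 0 (ξ, vstar ξ)) ^ 2 +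
          cy * euclNorm (S.nomOutput 0 (ξ, vstar ξ)) ^ 2) ≤
        S.value vstar ξ - η * euclNorm ξ ^ 2 := by
  have hcS := cS_pos (S := S) (cy := cy) hm hp hQ hR hcu
  have h1ε : 0 < 1 - ε := sub_pos.2 hε
  obtain ⟨c, hc, hlow⟩ := exists_mul_euclNorm_sq_le_wsq hQS
  -- The two entries of the minimum are the decrease rates in the extreme cases `π = ε` (from `Q_S`)
  -- and `π = 0` (from detectability alone).
  refine ⟨(1 - ε) * min c (S.cS cu cy / 2), by positivity, fun ξ hξ π hπ0 hπ => ?_⟩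
  set u := S.nomInput 0 (ξ, vstar ξ)
  set y := S.nomOutput 0 (ξ, vstar ξ)
  have hst : S.nomState 1 (ξ, vstar ξ) = S.A.mulVec ξ + S.B.mulVec u := S.nomState_succ' 0 _
  obtain ⟨hy, hu⟩ := cS_mul_le (S := S) (cy := cy) hm hp hQ hR hcu y u
  have hv := hval ξ hξ
  have hqs := hlow (Sum.elim ξ u)
  have hsum : euclNorm (Sum.elim ξ u) ^ 2 = euclNorm ξ ^ 2 + euclNorm u ^ 2 := by
    rw [euclNorm_sq, sumElim_dotProduct_sumElim, euclNorm_sq, euclNorm_sq]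
  rw [wsq_QS, ← hst, hsum] at hqs
  set V := S.value vstar ξ
  set N := euclNorm ξ ^ 2
  set Z := wsq Pu (S.nomState 1 (ξ, vstar ξ))
  set q := wsq S.Q y
  set r := wsq S.R u
  set cs := S.cS cu cy
  have hN : 0 ≤ N := sq_nonneg _
  have hq : 0 ≤ q := wsq_nonneg hQ.posSemidef _
  have hr : 0 ≤ r := wsq_nonneg hR.posSemidef _
  have hcN : 0 ≤ c * euclNorm u ^ 2 := by positivity
  have hmin1 : (1 - ε) * min c (cs / 2) * N ≤ (1 - ε) * (c * N) := by
    rw [mul_assoc]; gcongr; exact min_le_left _ _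
  have hmin2 : (1 - ε) * min c (cs / 2) * N ≤ (1 - ε) * (cs / 2 * N) := by
    rw [mul_assoc]; gcongr; exact min_le_right _ _
  have hZ : ε * (Z - wsq Pl ξ) ≤
      (1 - ε) * (cs / 2 * N + r - cs * cu * euclNorm u ^ 2 - c * N) := by
    have h1 : ε / (1 - ε) * (Z - wsq Pl ξ) ≤
        cs / 2 * N + r - cs * cu * euclNorm u ^ 2 - c * N := by linarith
    have h2 := mul_le_mul_of_nonneg_left h1 h1ε.le
    rwa [← mul_assoc, mul_div_cancel₀ _ h1ε.ne'] at h2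
  have hy' := mul_le_mul_of_nonneg_left hy h1ε.le
  have hu' := mul_le_mul_of_nonneg_left hu h1ε.le
  have hεV := mul_le_mul_of_nonneg_left hv hε0
  have hεq := mul_nonneg hε0 hq
  have hεr := mul_nonneg hε0 hr
  -- The left side is affine in `π`, so its slope decides which end of `[0, ε]` is the worst case.
  rcases le_total (Z - (V - (q + r))) 0 with hs | hs
  · have := mul_nonpos_of_nonneg_of_nonpos hπ0 hs
    linarith
  · have := mul_le_mul_of_nonneg_right hπ hs
    linarith

variable (S) in
/-- The Lyapunov function: optimal nominal cost plus a multiple of the detectability function. -/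
noncomputable def lyap (vstar : (XiIdx m p τ → ℝ) → Fin L → Fin m → ℝ)
    (PW : Matrix (XiIdx m p τ) (XiIdx m p τ) ℝ) (α : ℝ) (ξ : XiIdx m p τ → ℝ) : ℝ :=
  S.value vstar ξ + α * wsq PW ξ

theorem closedLoop_mem_roa {w : Fin Nv → ℝ} (hw : S.IsVertexWeights w)
    (hopt : S.IsNomOptimal vstar) {ξ : XiIdx m p τ → ℝ} (hξ : ξ ∈ S.roa) {d : Fin p → ℝ}
    (hd : d ∈ S.dset) : S.closedLoop vstar ξ d ∈ S.roa := by
  rw [closedLoop_eq]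
  exact hw.mem_roa (hopt ξ hξ).1.2 hd

/-- Growth of the Lyapunov function along one step, for a given disturbance. -/
theorem exists_lyap_closedLoop_le {w : Fin Nv → ℝ} (hw : S.IsVertexWeights w)
    (hopt : S.IsNomOptimal vstar) (hτ : 0 < τ) (hQ : S.Q.PosDef) (hP : S.P.PosDef)
    (hterm : S.TerminalDecrease) (hval : ∀ ξ ∈ S.roa, S.value vstar ξ ≤ wsq Pu ξ)
    (hcy : 0 < cy) (hcd : 0 < cd) (hIOSS : S.IsIOSSLyapunov PW cu cy cd) {α : ℝ} (hα : 0 ≤ α)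
    {θ : ℝ} (hθ : 0 < θ) :
    ∃ C, 0 ≤ C ∧ ∀ ξ ∈ S.roa, ∀ d ∈ S.dset, ∀ e,
      e = α * (wsq PW ξ + (-(1 / 2) * euclNorm ξ ^ 2 +
          cu * euclNorm (S.nomInput 0 (ξ, vstar ξ)) ^ 2 +
          cy * euclNorm (S.nomOutput 0 (ξ, vstar ξ)) ^ 2)) +
        θ * (1 + α * cy) * ‖(ξ, vstar ξ)‖ ^ 2 + C * euclNorm d ^ 2 →
      (S.candidate (vstar ξ) d ∈ S.feasible (S.closedLoop vstar ξ d) →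
        S.lyap vstar PW α (S.closedLoop vstar ξ d) ≤
          S.value vstar ξ - (wsq S.Q (S.nomOutput 0 (ξ, vstar ξ)) +
            wsq S.R (S.nomInput 0 (ξ, vstar ξ))) + e) ∧
      S.lyap vstar PW α (S.closedLoop vstar ξ d) ≤
        wsq Pu (S.nomState 1 (ξ, vstar ξ)) + e := by
  -- Young's inequality separates the disturbance in the candidate cost, in the upper bound at the
  -- successor, and in the measured output.
  obtain ⟨C₁, hC₁, h₁⟩ := QuadraticForm.exists_apply_add_le S.nomCost S.shiftLin S.distLin hθ
  obtain ⟨C₂, hC₂, h₂⟩ := QuadraticForm.exists_apply_add_le (wsqForm Pu)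
    (S.nomState 1 : Dec m p τ L →ₗ[ℝ] _) S.E.mulVecLin hθ
  obtain ⟨C₃, hC₃, h₃⟩ := QuadraticForm.exists_apply_add_le (wsqForm 1)
    (S.nomOutput 0 : Dec m p τ L →ₗ[ℝ] _) LinearMap.id hθ
  refine ⟨C₁ + C₂ + α * (cy * C₃ + cd), by positivity, ?_⟩
  rintro ξ hξ d hd e rfl
  set x : Dec m p τ L := (ξ, vstar ξ) with hx
  have hd2 := norm_sq_le_euclNorm_sq d
  have hroa := closedLoop_mem_roa hw hopt hξ hd
  have hW : wsq PW (S.closedLoop vstar ξ d) ≤ wsq PW ξ + (-(1 / 2) * euclNorm ξ ^ 2 +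
      cu * euclNorm (S.nomInput 0 x) ^ 2 + cy * euclNorm (S.nomOutput 0 x) ^ 2) +
      θ * cy * ‖x‖ ^ 2 + (cy * C₃ + cd) * euclNorm d ^ 2 := by
    have hi : wsq PW (S.closedLoop vstar ξ d) - wsq PW ξ ≤ -(1 / 2) * euclNorm ξ ^ 2 +
        cu * euclNorm (S.nomInput 0 x) ^ 2 + cy * euclNorm (S.nomOutput 0 x + d) ^ 2 +
          cd * euclNorm d ^ 2 := hIOSS ξ (S.nomInput 0 x) d
    have hy := h₃ x d
    rw [wsqForm_apply, wsqForm_apply, wsq_one, wsq_one, LinearMap.id_apply] at hy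
    have hy2 : euclNorm (S.nomOutput 0 x + d) ^ 2 ≤
        euclNorm (S.nomOutput 0 x) ^ 2 + θ * ‖x‖ ^ 2 + C₃ * euclNorm d ^ 2 :=
      hy.trans (by gcongr)
    have := mul_le_mul_of_nonneg_left hy2 hcy.le
    linarith
  have hW' := mul_le_mul_of_nonneg_left hW hα
  have hn1 : 0 ≤ C₁ * euclNorm d ^ 2 := by positivity
  have hn2 : 0 ≤ C₂ * euclNorm d ^ 2 := by positivity
  constructor
  · intro hf
    have h4 := (hopt _ hroa).2 _ hf
    rw [candidate_pair_eq, ← hx] at h4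
    have h5 := h₁ x d
    have h6 := hw.nomCost_shiftLin_le hτ hQ hP hterm x
    have h7 := mul_le_mul_of_nonneg_left hd2 hC₁
    rw [lyap, value, value, ← hx]
    linarith
  · have h4 := hval _ hroa
    have h5 := h₂ x d
    rw [wsqForm_apply, wsqForm_apply, Matrix.mulVecLin_apply, ← closedLoop_eq] at h5
    have h7 := mul_le_mul_of_nonneg_left hd2 hC₂
    rw [lyap]
    linarith

/-- The optimal cost exceeds its value at the origin by at most a quadratic in the state, and
together with the squared state it controls the optimal corrections. -/
theorem exists_norm_sq_le (hQ : S.Q.PosDef) (hR : S.R.PosDef) (hP : S.P.PosDef)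
    (hval : ∀ ξ ∈ S.roa, S.value vstar ξ ≤ wsq Pu ξ) :
    ∃ C, 0 < C ∧ ∀ ξ ∈ S.roa, ‖(ξ, vstar ξ)‖ ^ 2 ≤
      C * (euclNorm ξ ^ 2 + S.nomCost (0, vstar 0)) := by
  obtain ⟨c, hc, h⟩ := exists_norm_sq_le_nomCost_add (S := S) hQ hR hP
  obtain ⟨b, hb, hPu⟩ := exists_wsq_le Pu
  refine ⟨(b + 1) / c, by positivity, fun ξ hξ => ?_⟩
  have h1 := h (ξ, vstar ξ)
  have h2 := hval ξ hξ
  have h3 := hPu ξ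
  have h4 := nomCost_nonneg hQ hR hP ((0 : XiIdx m p τ → ℝ), vstar 0)
  rw [value] at h2
  rw [div_mul_eq_mul_div, le_div_iff₀ hc]
  simp only at h1
  nlinarith [mul_nonneg hb.le h4]

/-- Geometric drift of the Lyapunov function, uniformly over the admissible laws. -/
theorem exists_lyap_drift (hm : 0 < m) (hp : 0 < p) (hτ : 0 < τ) (hD : IsCompact S.dset)
    (hD0 : (0 : Fin p → ℝ) ∈ S.dset) (hQ : S.Q.PosDef) (hR : S.R.PosDef) (hP : S.P.PosDef)
    {w : Fin Nv → ℝ} (hw : S.IsVertexWeights w) (hterm : S.TerminalDecrease)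
    (h0 : (0 : XiIdx m p τ → ℝ) ∈ S.roa) (hopt : S.IsNomOptimal vstar) (hPl : Pl.PosSemidef)
    (hval : ∀ ξ ∈ S.roa, wsq Pl ξ ≤ S.value vstar ξ ∧ S.value vstar ξ ≤ wsq Pu ξ)
    (hPW : PW.PosDef) (hcu : 0 < cu) (hcy : 0 < cy) (hcd : 0 < cd)
    (hIOSS : S.IsIOSSLyapunov PW cu cy cd) (hε0 : 0 ≤ ε) (hε : ε < 1)
    (hQS : (S.QS Pl Pu cu cy ε S.A S.B).PosDef) :
    ∃ α a b γ C : ℝ, 0 < a ∧ 0 < b ∧ 0 < γ ∧ γ < 1 ∧ 0 < C ∧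
      (∀ ξ ∈ S.roa, a * euclNorm ξ ^ 2 ≤ S.lyap vstar PW α ξ ∧
        S.lyap vstar PW α ξ ≤ b * euclNorm ξ ^ 2) ∧
      ∀ ν, S.IsDisturbanceLaw ν → S.CandidateInfeasibleLE ν vstar ε → ∀ ξ ∈ S.roa,
        ∫⁻ d, ENNReal.ofReal (S.lyap vstar PW α (S.closedLoop vstar ξ d))
            ∂(ν : Measure (Fin p → ℝ)) ≤
          ENNReal.ofReal ((1 - γ) * S.lyap vstar PW α ξ + C * (covMatrix ν).trace) := by
  have hcS := cS_pos (S := S) (cy := cy) hm hp hQ hR hcu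
  have h1ε : 0 < 1 - ε := sub_pos.2 hε
  set α := (1 - ε) * S.cS cu cy with hαdef
  have hα : 0 < α := mul_pos h1ε hcS
  obtain ⟨η, hη, hdec⟩ := exists_nominal_decrease hm hp hQ hR hcu hε0 hε hQS
    fun ξ hξ => (hval ξ hξ).1
  obtain ⟨Cx, hCx, hx⟩ := exists_norm_sq_le hQ hR hP fun ξ hξ => (hval ξ hξ).2
  obtain ⟨C0, hC0, hc0⟩ := hopt.exists_nomCost_zero_le hD hD0 hw hτ hQ hR hP hterm h0
    (fun ξ hξ => (wsq_nonneg hPl ξ).trans (hval ξ hξ).1) hε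
  -- With this `θ` the Young error consumes half of the decrease rate `η`, apart from a multiple of
  -- the cost at the origin.
  obtain ⟨θ, hθ, hθeq⟩ : ∃ θ, 0 < θ ∧ θ * (1 + α * cy) * Cx = η / 2 :=
    ⟨η / (2 * ((1 + α * cy) * Cx)), by positivity, by field_simp⟩
  obtain ⟨C1, hC1, hstep⟩ := exists_lyap_closedLoop_le hw hopt hτ hQ hP hterm
    (fun ξ hξ => (hval ξ hξ).2) hcy hcd hIOSS hα.le hθ
  obtain ⟨aW, haW, hWlow⟩ := exists_mul_euclNorm_sq_le_wsq hPW
  obtain ⟨bW, hbW, hWup⟩ := exists_wsq_le PW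
  obtain ⟨bu, hbu, hPuup⟩ := exists_wsq_le Pu
  -- The surplus `η` in the upper constant ensures `η ≤ b`, so that `γ = η / (2 * b)` is below one.
  have hbounds : ∀ ξ ∈ S.roa, α * aW * euclNorm ξ ^ 2 ≤ S.lyap vstar PW α ξ ∧
      S.lyap vstar PW α ξ ≤ (bu + α * bW + η) * euclNorm ξ ^ 2 := fun ξ hξ => by
    have e1 := mul_le_mul_of_nonneg_left (hWlow ξ) hα.le
    have e2 := mul_le_mul_of_nonneg_left (hWup ξ) hα.le
    have e3 := (wsq_nonneg hPl ξ).trans (hval ξ hξ).1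
    have e4 := (hval ξ hξ).2.trans (hPuup ξ)
    have e5 : 0 ≤ η * euclNorm ξ ^ 2 := by positivity
    rw [lyap]
    constructor <;> linarith
  set b := bu + α * bW + η with hb
  have hbpos : 0 < b := by positivity
  have hηb : η ≤ b := by rw [hb]; nlinarith [mul_pos hα hbW]
  refine ⟨α, α * aW, b, η / (2 * b), η / 2 * C0 + C1 + 1, by positivity, hbpos, by positivity, ?_,
    by positivity, hbounds, fun ν hν hcand ξ hξ => ?_⟩
  · rw [div_lt_one (by positivity)]
    linarith
  set F : Set (Fin p → ℝ) := {d | S.candidate (vstar ξ) d ∈ S.feasible (S.closedLoop vstar ξ d)}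
    with hF
  have hFm : MeasurableSet F := (isClosed_candidate_feasible ξ).measurableSet
  set Vf := S.value vstar ξ - (wsq S.Q (S.nomOutput 0 (ξ, vstar ξ)) +
            wsq S.R (S.nomInput 0 (ξ, vstar ξ))) with hVf
  set Vi := wsq Pu (S.nomState 1 (ξ, vstar ξ)) with hVi
  set k := α * (wsq PW ξ + (-(1 / 2) * euclNorm ξ ^ 2 +
          cu * euclNorm (S.nomInput 0 (ξ, vstar ξ)) ^ 2 +
          cy * euclNorm (S.nomOutput 0 (ξ, vstar ξ)) ^ 2)) +
        θ * (1 + α * cy) * ‖(ξ, vstar ξ)‖ ^ 2 with hk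
  -- An integrable majorant built on the two feasibility events. The composite Lyapunov function
  -- needs no measurability here, since the lower integral is monotone regardless.
  let h : (Fin p → ℝ) → ℝ := fun d => F.indicator (fun _ => Vf) d + Fᶜ.indicator (fun _ => Vi) d +
    (k + C1 * euclNorm d ^ 2)
  have hle : ∀ᵐ d ∂(ν : Measure (Fin p → ℝ)), S.lyap vstar PW α (S.closedLoop vstar ξ d) ≤ h d := by
    filter_upwards [hν.1] with d hd
    obtain ⟨e1, e2⟩ := hstep ξ hξ d hd (k + C1 * euclNorm d ^ 2) rfl
    by_cases hdF : d ∈ F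
    · simpa only [h, Set.indicator_of_mem hdF, Set.indicator_of_notMem (Set.notMem_compl_iff.2 hdF),
        add_zero] using e1 hdF
    · simpa only [h, Set.indicator_of_notMem hdF, Set.indicator_of_mem (Set.mem_compl hdF),
        zero_add] using e2
  have hnn : ∀ᵐ d ∂(ν : Measure (Fin p → ℝ)), 0 ≤ h d := by
    filter_upwards [hle, hν.1] with d hd hdD
    refine le_trans ?_ hd
    exact le_trans (by positivity) (hbounds _ (closedLoop_mem_roa hw hopt hξ hdD)).1
  have iN : Integrable (fun d => euclNorm d ^ 2) (ν : Measure (Fin p → ℝ)) :=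
    hν.integrable_of_continuous hD (continuous_euclNorm.pow 2)
  have i1 : Integrable (F.indicator fun _ => Vf) (ν : Measure (Fin p → ℝ)) :=
    (integrable_const _).indicator hFm
  have i2 : Integrable (Fᶜ.indicator fun _ => Vi) (ν : Measure (Fin p → ℝ)) :=
    (integrable_const _).indicator hFm.compl
  have i3 : Integrable (fun d => k + C1 * euclNorm d ^ 2) (ν : Measure (Fin p → ℝ)) :=
    (integrable_const _).add (iN.const_mul _)
  have hint : Integrable h (ν : Measure (Fin p → ℝ)) := (i1.add i2).add i3
  have hval_int : ∫ d, h d ∂(ν : Measure (Fin p → ℝ)) =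
      (ν : Measure (Fin p → ℝ)).real F * Vf + (ν : Measure (Fin p → ℝ)).real Fᶜ * Vi +
        (k + C1 * (covMatrix ν).trace) := by
    rw [trace_covMatrix hν hD]
    change ∫ d, (F.indicator (fun _ => Vf) d + Fᶜ.indicator (fun _ => Vi) d +
      (k + C1 * euclNorm d ^ 2)) ∂(ν : Measure (Fin p → ℝ)) = _
    rw [integral_add (i1.fun_add i2) i3, integral_add i1 i2,
      integral_add (integrable_const _) (iN.const_mul _), integral_indicator_const _ hFm,
      integral_indicator_const _ hFm.compl, integral_const_mul]
    simp
  calc ∫⁻ d, ENNReal.ofReal (S.lyap vstar PW α (S.closedLoop vstar ξ d))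
          ∂(ν : Measure (Fin p → ℝ))
      ≤ ∫⁻ d, ENNReal.ofReal (h d) ∂(ν : Measure (Fin p → ℝ)) :=
        lintegral_mono_ae (hle.mono fun d hd => ENNReal.ofReal_le_ofReal hd)
    _ = ENNReal.ofReal (∫ d, h d ∂(ν : Measure (Fin p → ℝ))) :=
        (ofReal_integral_eq_lintegral_ofReal hint hnn).symm
    _ ≤ _ := by
      refine ENNReal.ofReal_le_ofReal ?_
      have hπ : (ν : Measure (Fin p → ℝ)).real Fᶜ ≤ ε := hcand ξ hξ
      have hF1 : (ν : Measure (Fin p → ℝ)).real F = 1 - (ν : Measure (Fin p → ℝ)).real Fᶜ := by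
        rw [probReal_compl_eq_one_sub hFm]; ring
      have hd := hdec ξ hξ _ measureReal_nonneg hπ
      rw [← hαdef, ← hVf, ← hVi] at hd
      have hxx := mul_le_mul_of_nonneg_left (hx ξ hξ)
        (show 0 ≤ θ * (1 + α * cy) by positivity)
      rw [← mul_assoc, hθeq] at hxx
      have hcc := mul_le_mul_of_nonneg_left (hc0 ν hν hcand) (half_pos hη).le
      have hγ : η / (2 * b) * S.lyap vstar PW α ξ ≤ η / 2 * euclNorm ξ ^ 2 := by
        calc η / (2 * b) * S.lyap vstar PW α ξ ≤ η / (2 * b) * (b * euclNorm ξ ^ 2) := by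
              gcongr; exact (hbounds ξ hξ).2
          _ = η / 2 * euclNorm ξ ^ 2 := by field_simp
      have htr := trace_covMatrix_nonneg hν hD
      rw [hval_int, hF1, hk]
      have hlyap : S.lyap vstar PW α ξ = S.value vstar ξ + α * wsq PW ξ := rfl
      linarith

end DPC

/-! ### Trajectories driven by independent disturbances -/

section Trajectories

variable {X D : Type*} {f : X → D → X}

theorem trajectory_congr {x₀ : X} {δ δ' : ℕ → D} {k : ℕ} (h : ∀ i < k, δ i = δ' i) :
    trajectory f x₀ δ k = trajectory f x₀ δ' k := by
  induction k with
  | zero => rfl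
  | succ k ih => rw [trajectory, trajectory, ih fun i hi => h i (by omega), h k (by omega)]

variable [MeasurableSpace X] [MeasurableSpace D]

theorem measurable_trajectory (hf : Measurable (Function.uncurry f)) (x₀ : X) (k : ℕ) :
    Measurable fun δ => trajectory f x₀ δ k := by
  induction k with
  | zero => exact measurable_const
  | succ k ih => exact hf.comp (ih.prodMk (measurable_pi_apply k))

/-- The state at time `k` is a function of the disturbances before `k`, which form a block
independent of the disturbance at `k`. -/
theorem indepFun_trajectory (hf : Measurable (Function.uncurry f)) (x₀ : X)
    (ν : Measure D) [IsProbabilityMeasure ν] (k : ℕ) :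
    ProbabilityTheory.IndepFun (fun δ => trajectory f x₀ δ k) (fun δ => δ k)
      (Measure.infinitePi fun _ : ℕ => ν) := by
  obtain ⟨d₀⟩ : Nonempty D := nonempty_of_isProbabilityMeasure ν
  have hind : ProbabilityTheory.iIndepFun (fun i (δ : ℕ → D) => δ i)
      (Measure.infinitePi fun _ : ℕ => ν) :=
    ProbabilityTheory.iIndepFun_infinitePi (X := fun _ d => d) fun _ => measurable_id
  have h := hind.indepFun_finset (Finset.range k) {k} (by simp) fun i => measurable_pi_apply i
  -- The finite past is completed by an arbitrary `d₀`, which the state at time `k` does not see.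
  let past : (Finset.range k → D) → ℕ → D := fun g i =>
    if hi : i ∈ Finset.range k then g ⟨i, hi⟩ else d₀
  have hpast : Measurable past := measurable_pi_lambda _ fun i => by
    by_cases hi : i ∈ Finset.range k
    · simpa only [past, hi, dif_pos] using measurable_pi_apply _
    · simpa only [past, hi, dif_neg, not_false_eq_true] using measurable_const
  have h2 := h.comp ((measurable_trajectory hf x₀ k).comp hpast)
    (measurable_pi_apply (⟨k, Finset.mem_singleton_self k⟩ : ({k} : Finset ℕ)))
  have hpt : (fun δ => trajectory f x₀ δ k) =
      fun δ : ℕ → D => trajectory f x₀ (past fun i => δ i) k :=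
    funext fun δ => trajectory_congr fun i hi => by simp [past, hi]
  rw [hpt]
  exact h2

/-- By independence the joint law of current state and disturbance is a product, and Tonelli's
theorem applies: this is the Markov property in integrated form. -/
theorem lintegral_trajectory_succ (hf : Measurable (Function.uncurry f)) (x₀ : X)
    (ν : Measure D) [IsProbabilityMeasure ν] {g : X → ENNReal} (hg : Measurable g) (k : ℕ) :
    ∫⁻ δ, g (trajectory f x₀ δ (k + 1)) ∂(Measure.infinitePi fun _ : ℕ => ν) =
      ∫⁻ δ, ∫⁻ d, g (f (trajectory f x₀ δ k) d) ∂ν ∂(Measure.infinitePi fun _ : ℕ => ν) := by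
  have hm := measurable_trajectory hf x₀ k
  have hk : Measurable fun δ : ℕ → D => δ k := measurable_pi_apply k
  have hmap := (ProbabilityTheory.indepFun_iff_map_prod_eq_prod_map_map hm.aemeasurable
    hk.aemeasurable).1 (indepFun_trajectory hf x₀ ν k)
  have hν : (Measure.infinitePi fun _ : ℕ => ν).map (fun δ => δ k) = ν :=
    (measurePreserving_eval_infinitePi (fun _ : ℕ => ν) k).map_eq
  have hgf : Measurable fun z : X × D => g (f z.1 z.2) := hg.comp hf
  calc ∫⁻ δ, g (trajectory f x₀ δ (k + 1)) ∂(Measure.infinitePi fun _ : ℕ => ν)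
      = ∫⁻ z, g (f z.1 z.2) ∂((Measure.infinitePi fun _ : ℕ => ν).map
          fun δ => (trajectory f x₀ δ k, δ k)) := by
        rw [lintegral_map hgf (hm.prodMk hk)]; rfl
    _ = ∫⁻ x, ∫⁻ d, g (f x d) ∂ν
          ∂((Measure.infinitePi fun _ : ℕ => ν).map fun δ => trajectory f x₀ δ k) := by
        rw [hmap, hν, lintegral_prod _ hgf.aemeasurable]
    _ = _ := lintegral_map hgf.lintegral_prod_right' hm

end Trajectories

/-! ### From geometric drift to stability in expectation -/

theorem Real.sqrt_add_le_add_sqrt {x y : ℝ} (hx : 0 ≤ x) (hy : 0 ≤ y) : √(x + y) ≤ √x + √y := by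
  rw [Real.sqrt_le_iff]
  refine ⟨by positivity, ?_⟩
  rw [add_sq, Real.sq_sqrt hx, Real.sq_sqrt hy]
  have : 0 ≤ 2 * √x * √y := by positivity
  linarith

theorem isClassKL_geometric {M lam : ℝ} (hM : 0 < M) (h0 : 0 < lam) (h1 : lam < 1) :
    IsClassKL fun r t => M * r * lam ^ t := by
  constructor
  · intro t _
    have hp : 0 < lam ^ t := Real.rpow_pos_of_pos h0 t
    refine ⟨by fun_prop, fun a _ b _ hab => ?_, by simp⟩
    simp only
    gcongr
  · intro r hr
    have hMr : 0 < M * r := mul_pos hM hr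
    refine ⟨?_, fun a _ b _ hab => ?_, ?_⟩
    · exact (continuous_const.mul (Real.continuous_const_rpow h0.ne')).continuousOn
    · exact mul_lt_mul_of_pos_left (Real.rpow_lt_rpow_of_exponent_gt h0 h1 hab) hMr
    · simpa using (tendsto_rpow_atTop_of_base_lt_one lam (by linarith) h1).const_mul (M * r)

theorem isClassK_sqrt_mul {c : ℝ} (hc : 0 < c) : IsClassK fun s => Real.sqrt (c * s) := by
  refine ⟨by fun_prop, fun a ha b _ hab => ?_, by simp⟩
  exact Real.sqrt_lt_sqrt (mul_nonneg hc.le ha) (mul_lt_mul_of_pos_left hab hc)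

/-- A nonnegative function with bounded second moment is integrable, with a mean bounded by the root
of the second moment. -/
theorem integrable_and_integral_le_sqrt {Ω : Type*} [MeasurableSpace Ω] {P : Measure Ω}
    [IsProbabilityMeasure P] {g : Ω → ℝ} (hg : AEStronglyMeasurable g P) {M : ℝ} (hM : 0 ≤ M)
    (h : ∫⁻ ω, ENNReal.ofReal (g ω ^ 2) ∂P ≤ ENNReal.ofReal M) :
    Integrable g P ∧ ∫ ω, g ω ∂P ≤ Real.sqrt M := by
  have hsq : Integrable (fun ω => g ω ^ 2) P := by
    refine ⟨hg.pow 2, ?_⟩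
    rw [hasFiniteIntegral_iff_ofReal (ae_of_all _ fun ω => sq_nonneg _)]
    exact h.trans_lt ENNReal.ofReal_lt_top
  have hgL2 : MemLp g 2 P := (memLp_two_iff_integrable_sq hg).2 hsq
  have hgi : Integrable g P := hgL2.integrable one_le_two
  refine ⟨hgi, Real.le_sqrt_of_sq_le ?_⟩
  have h1 : (∫ ω, g ω ∂P) ^ 2 ≤ ∫ ω, g ω ^ 2 ∂P :=
    (even_two.convexOn_pow (𝕜 := ℝ)).map_integral_le (continuous_pow 2).continuousOn isClosed_univ
      (ae_of_all _ fun _ => Set.mem_univ _) hgi hsq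
  refine h1.trans ?_
  rwa [← ofReal_integral_eq_lintegral_ofReal hsq (ae_of_all _ fun ω => sq_nonneg _),
    ENNReal.ofReal_le_ofReal_iff hM] at h

/-! ### Measurability of the closed loop and iteration of the drift -/

namespace DPC

variable {m p τ L Nv nD nC nX : ℕ} {S : DPC m p τ L Nv nD nC nX}
  {vstar vstar' : (XiIdx m p τ → ℝ) → Fin L → Fin m → ℝ}
  {PW : Matrix (XiIdx m p τ) (XiIdx m p τ) ℝ} {ε : ℝ}

theorem measurable_closedLoop (hv : Measurable vstar) :
    Measurable (Function.uncurry (S.closedLoop vstar)) := by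
  have h1 : Measurable fun z : (XiIdx m p τ → ℝ) × (Fin p → ℝ) => (z.1, vstar z.1) :=
    measurable_fst.prodMk (hv.comp measurable_fst)
  have h2 : Continuous (S.nomState 1 : Dec m p τ L →ₗ[ℝ] _) :=
    LinearMap.continuous_of_finiteDimensional _
  have h3 : Continuous S.E.mulVecLin := LinearMap.continuous_of_finiteDimensional _
  have : Function.uncurry (S.closedLoop vstar) = fun z =>
      S.nomState 1 (z.1, vstar z.1) + S.E.mulVecLin z.2 := by
    funext z
    exact closedLoop_eq z.1 z.2
  rw [this]
  exact (h2.measurable.comp h1).add (h3.measurable.comp measurable_snd)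

theorem measurable_lyap (hv : Measurable vstar) (α : ℝ) : Measurable (S.lyap vstar PW α) := by
  have h1 : Measurable fun ξ => (ξ, vstar ξ) := measurable_id.prodMk hv
  have h2 := (QuadraticForm.continuous_of_finiteDimensional S.nomCost).measurable
  exact ((h2.comp h1).sub_const _).add ((continuous_wsq PW).measurable.const_mul α)

theorem closedLoop_congr {ξ : XiIdx m p τ → ℝ} (h : vstar' ξ = vstar ξ) (d : Fin p → ℝ) :
    S.closedLoop vstar' ξ d = S.closedLoop vstar ξ d := by
  rw [closedLoop, closedLoop, control, control, h]

/-- The feedback is arbitrary outside the invariant region, possibly not measurable, but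
trajectories never leave it. The feedback may thus be replaced by a measurable one that agrees on
the region. -/
theorem trajectory_mem_and_eq (hinv : ∀ ξ ∈ S.roa, ∀ d ∈ S.dset, S.closedLoop vstar ξ d ∈ S.roa)
    (heq : ∀ ξ ∈ S.roa, vstar' ξ = vstar ξ) {x₀ : XiIdx m p τ → ℝ} (hx₀ : x₀ ∈ S.roa)
    {δ : ℕ → Fin p → ℝ} (hδ : ∀ k, δ k ∈ S.dset) (k : ℕ) :
    trajectory (S.closedLoop vstar) x₀ δ k ∈ S.roa ∧
      trajectory (S.closedLoop vstar') x₀ δ k = trajectory (S.closedLoop vstar) x₀ δ k := by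
  induction k with
  | zero => exact ⟨hx₀, rfl⟩
  | succ k ih =>
    refine ⟨hinv _ ih.1 _ (hδ k), ?_⟩
    rw [trajectory, trajectory, ih.2, closedLoop_congr (heq _ ih.1)]

/-- The constant `t / γ` is the fixed point of `s ↦ (1 - γ) * s + t`, so the one-step drift
reproduces the bound. The modified feedback `vstar'` supplies the measurability required for
conditioning. -/
theorem lintegral_lyap_trajectory_le {ν : ProbabilityMeasure (Fin p → ℝ)}
    (hν : S.IsDisturbanceLaw ν)
    (hinv : ∀ ξ ∈ S.roa, ∀ d ∈ S.dset, S.closedLoop vstar ξ d ∈ S.roa)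
    (h0 : (0 : XiIdx m p τ → ℝ) ∈ S.roa)
    (heq : ∀ ξ ∈ S.roa, vstar' ξ = vstar ξ) (hmeas : Measurable vstar') {α γ t : ℝ}
    (hγ : 0 < γ) (hγ1 : γ < 1) (ht : 0 ≤ t)
    (hnn : ∀ ξ ∈ S.roa, 0 ≤ S.lyap vstar PW α ξ)
    (hdrift : ∀ ξ ∈ S.roa, ∫⁻ d, ENNReal.ofReal (S.lyap vstar PW α (S.closedLoop vstar ξ d))
            ∂(ν : Measure (Fin p → ℝ)) ≤
          ENNReal.ofReal ((1 - γ) * S.lyap vstar PW α ξ + t))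
    {x₀ : XiIdx m p τ → ℝ} (hx₀ : x₀ ∈ S.roa) (k : ℕ) :
    ∫⁻ δ, ENNReal.ofReal (S.lyap vstar PW α (trajectory (S.closedLoop vstar) x₀ δ k))
        ∂(Measure.infinitePi fun _ : ℕ => (ν : Measure (Fin p → ℝ))) ≤
      ENNReal.ofReal ((1 - γ) ^ k * S.lyap vstar PW α x₀ + t / γ) := by
  have hlyap : ∀ ξ ∈ S.roa, S.lyap vstar' PW α ξ = S.lyap vstar PW α ξ := fun ξ hξ => by
    rw [lyap, lyap, value, value, heq ξ hξ, heq 0 h0]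
  have hγ1' : 0 ≤ 1 - γ := by linarith
  have hgm : Measurable fun ξ => ENNReal.ofReal (S.lyap vstar' PW α ξ) :=
    (measurable_lyap hmeas α).ennreal_ofReal
  have hfm := measurable_closedLoop (S := S) hmeas
  have hae : ∀ k, ∀ᵐ δ ∂(Measure.infinitePi fun _ : ℕ => (ν : Measure (Fin p → ℝ))),
      trajectory (S.closedLoop vstar) x₀ δ k ∈ S.roa ∧
      trajectory (S.closedLoop vstar') x₀ δ k = trajectory (S.closedLoop vstar) x₀ δ k := fun k =>
    hν.ae_forall_mem.mono fun δ hδ => trajectory_mem_and_eq hinv heq hx₀ hδ k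
  have hcongr : ∀ k, ∫⁻ δ, ENNReal.ofReal
        (S.lyap vstar PW α (trajectory (S.closedLoop vstar) x₀ δ k))
        ∂(Measure.infinitePi fun _ : ℕ => (ν : Measure (Fin p → ℝ))) =
      ∫⁻ δ, ENNReal.ofReal (S.lyap vstar' PW α (trajectory (S.closedLoop vstar') x₀ δ k))
        ∂(Measure.infinitePi fun _ : ℕ => (ν : Measure (Fin p → ℝ))) := fun k =>
    lintegral_congr_ae ((hae k).mono fun δ hδ => by
      simp only
      rw [hδ.2, hlyap _ hδ.1])
  induction k with
  | zero =>
    simp only [trajectory, lintegral_const, measure_univ, mul_one, pow_zero, one_mul]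
    exact ENNReal.ofReal_le_ofReal (le_add_of_nonneg_right (by positivity))
  | succ k ih =>
    rw [hcongr, lintegral_trajectory_succ hfm x₀ _ hgm]
    calc _ ≤ ∫⁻ δ, (ENNReal.ofReal (1 - γ) * ENNReal.ofReal
            (S.lyap vstar' PW α (trajectory (S.closedLoop vstar') x₀ δ k)) + ENNReal.ofReal t)
            ∂(Measure.infinitePi fun _ : ℕ => (ν : Measure (Fin p → ℝ))) := by
          refine lintegral_mono_ae ((hae k).mono fun δ hδ => ?_)
          rw [hδ.2, hlyap _ hδ.1, ← ENNReal.ofReal_mul hγ1',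
            ← ENNReal.ofReal_add (mul_nonneg hγ1' (hnn _ hδ.1)) ht]
          refine le_trans (le_of_eq (lintegral_congr_ae (hν.1.mono fun d hd => ?_)))
            (hdrift _ hδ.1)
          simp only
          rw [closedLoop_congr (heq _ hδ.1), hlyap _ (hinv _ hδ.1 d hd)]
      _ = ENNReal.ofReal (1 - γ) * ∫⁻ δ, ENNReal.ofReal
            (S.lyap vstar' PW α (trajectory (S.closedLoop vstar') x₀ δ k))
            ∂(Measure.infinitePi fun _ : ℕ => (ν : Measure (Fin p → ℝ))) + ENNReal.ofReal t := by
          have hm : Measurable fun δ => ENNReal.ofReal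
              (S.lyap vstar' PW α (trajectory (S.closedLoop vstar') x₀ δ k)) :=
            hgm.comp (measurable_trajectory hfm x₀ k)
          rw [lintegral_add_right _ measurable_const, lintegral_const_mul _ hm]
          simp
      _ ≤ ENNReal.ofReal (1 - γ) * ENNReal.ofReal ((1 - γ) ^ k * S.lyap vstar PW α x₀ + t / γ) +
            ENNReal.ofReal t := by
          rw [← hcongr]
          gcongr
      _ = _ := by
          have h1 : 0 ≤ (1 - γ) ^ k * S.lyap vstar PW α x₀ + t / γ :=
            add_nonneg (mul_nonneg (pow_nonneg hγ1' k) (hnn _ hx₀)) (by positivity)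
          rw [← ENNReal.ofReal_mul hγ1', ← ENNReal.ofReal_add (mul_nonneg hγ1' h1) ht]
          congr 1
          field_simp
          ring

/-- Stability in expectation from a geometric drift that is uniform over the admissible laws. -/
theorem isRASiE_of_lyap_drift (hD : IsCompact S.dset)
    (h0 : (0 : XiIdx m p τ → ℝ) ∈ interior S.roa)
    (hinv : ∀ ξ ∈ S.roa, ∀ d ∈ S.dset, S.closedLoop vstar ξ d ∈ S.roa)
    (hmeas : Measurable (S.roa.indicator vstar)) {α a b γ C : ℝ} (ha : 0 < a) (hb : 0 < b)
    (hγ : 0 < γ) (hγ1 : γ < 1) (hC : 0 < C)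
    (hbounds : ∀ ξ ∈ S.roa, a * euclNorm ξ ^ 2 ≤ S.lyap vstar PW α ξ ∧
      S.lyap vstar PW α ξ ≤ b * euclNorm ξ ^ 2)
    (hdrift : ∀ ν, S.IsDisturbanceLaw ν → S.CandidateInfeasibleLE ν vstar ε → ∀ ξ ∈ S.roa,
      ∫⁻ d, ENNReal.ofReal (S.lyap vstar PW α (S.closedLoop vstar ξ d))
          ∂(ν : Measure (Fin p → ℝ)) ≤
        ENNReal.ofReal ((1 - γ) * S.lyap vstar PW α ξ + C * (covMatrix ν).trace)) :
    IsRASiE (S.closedLoop vstar) S.roa S.dset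
      {ν | S.IsDisturbanceLaw ν ∧ S.CandidateInfeasibleLE ν vstar ε} := by
  have hγ1' : 0 < 1 - γ := by linarith
  -- These are the roots of the two parts of the second-moment bound `M` below, split by
  -- subadditivity of the square root; hence the decay rate `√(1 - γ)`.
  refine ⟨S.isClosed_roa, h0, hinv, fun r t => Real.sqrt (b / a) * r * Real.sqrt (1 - γ) ^ t,
    fun s => Real.sqrt (C / (γ * a) * s), isClassKL_geometric (by positivity) (by positivity) ?_,
    isClassK_sqrt_mul (by positivity), ?_⟩
  · rw [Real.sqrt_lt' one_pos]
    linarith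
  rintro ν ⟨hν, hcand⟩ x₀ hx₀ k
  have h0' := interior_subset h0
  have heq : ∀ ξ ∈ S.roa, S.roa.indicator vstar ξ = vstar ξ := fun ξ hξ =>
    Set.indicator_of_mem hξ vstar
  have htr := trace_covMatrix_nonneg hν hD
  have hnn : ∀ ξ ∈ S.roa, 0 ≤ S.lyap vstar PW α ξ := fun ξ hξ =>
    le_trans (by positivity) (hbounds ξ hξ).1
  have hE := lintegral_lyap_trajectory_le hν hinv h0' heq hmeas hγ hγ1
    (mul_nonneg hC.le htr) hnn (hdrift ν hν hcand) hx₀ k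
  have hae := hν.ae_forall_mem.mono fun δ hδ => trajectory_mem_and_eq hinv heq hx₀ hδ k
  set M := ((1 - γ) ^ k * (b * euclNorm x₀ ^ 2) + C * (covMatrix ν).trace / γ) / a with hMdef
  have hM : 0 ≤ M := by positivity
  have hsm : AEStronglyMeasurable
      (fun δ => euclNorm (trajectory (S.closedLoop vstar) x₀ δ k))
      (Measure.infinitePi fun _ : ℕ => (ν : Measure (Fin p → ℝ))) := by
    refine AEStronglyMeasurable.congr (f := fun δ =>
      euclNorm (trajectory (S.closedLoop (S.roa.indicator vstar)) x₀ δ k)) ?_ ?_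
    · exact (continuous_euclNorm.measurable.comp
        (measurable_trajectory (measurable_closedLoop hmeas) x₀ k)).aestronglyMeasurable
    · exact hae.mono fun δ hδ => by simp only [hδ.2]
  have hsecond : ∫⁻ δ, ENNReal.ofReal
        (euclNorm (trajectory (S.closedLoop vstar) x₀ δ k) ^ 2)
        ∂(Measure.infinitePi fun _ : ℕ => (ν : Measure (Fin p → ℝ))) ≤ ENNReal.ofReal M := by
    have h1 : ENNReal.ofReal a * ∫⁻ δ, ENNReal.ofReal
        (euclNorm (trajectory (S.closedLoop vstar) x₀ δ k) ^ 2)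
        ∂(Measure.infinitePi fun _ : ℕ => (ν : Measure (Fin p → ℝ))) ≤
        ENNReal.ofReal (a * M) := by
      rw [← lintegral_const_mul' _ _ ENNReal.ofReal_ne_top]
      refine le_trans (lintegral_mono_ae (hae.mono fun δ hδ => ?_)) (hE.trans ?_)
      · rw [← ENNReal.ofReal_mul ha.le]
        exact ENNReal.ofReal_le_ofReal (hbounds _ hδ.1).1
      · refine ENNReal.ofReal_le_ofReal ?_
        rw [hMdef, mul_div_cancel₀ _ ha.ne']
        gcongr
        exact (hbounds x₀ hx₀).2
    rw [ENNReal.ofReal_mul ha.le] at h1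
    exact (ENNReal.mul_le_mul_iff_right (by simpa using ha) ENNReal.ofReal_ne_top).1 h1
  obtain ⟨hint, hle⟩ := integrable_and_integral_le_sqrt hsm hM hsecond
  refine ⟨hint, hle.trans ?_⟩
  have hsplit : M = b / a * euclNorm x₀ ^ 2 * (1 - γ) ^ k + C / (γ * a) * (covMatrix ν).trace := by
    rw [hMdef]
    field_simp
  rw [hsplit]
  refine (Real.sqrt_add_le_add_sqrt (by positivity) (by positivity)).trans (le_of_eq ?_)
  congr 1
  simp only [Real.rpow_natCast]
  rw [Real.sqrt_mul (by positivity), Real.sqrt_mul (by positivity),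
    Real.sqrt_sq (euclNorm_nonneg _)]
  congr 1
  rw [Real.sqrt_eq_iff_mul_self_eq (by positivity) (by positivity), ← mul_pow,
    Real.mul_self_sqrt hγ1'.le]

end DPC

theorem theorem2 {m p τ L Nv nD nC nX T n₁ n₂ : ℕ}
    (hm : 0 < m) (hp : 0 < p) (hτ : 0 < τ) (hL : 0 < L)
    (S : DPC m p τ L Nv nD nC nX)
    -- disturbance set and weights
    (hDcompact : IsCompact S.dset) (hD0 : (0 : Fin p → ℝ) ∈ S.dset)
    (hQ : S.Q.PosDef) (hR : S.R.PosDef) (hP : S.P.PosDef)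
    -- recorded data of the true system, with unknown disturbances `dd` in the disturbance set
    (ud : ℤ → Fin m → ℝ) (yd : ℤ → Fin p → ℝ) (dd : Fin T → Fin p → ℝ)
    (hdd : ∀ i, dd i ∈ S.dset)
    (hdata : ∀ i : Fin T, yd ((i : ℕ) + 1) = S.Φ.mulVec (extState τ ud yd ((i : ℕ) + 1)) +
      S.Ψ.mulVec (ud ((i : ℕ) + 1)) + dd i)
    (hrank : (dataS τ T ud yd).rank = Fintype.card (XiIdx m p τ ⊕ Fin m))
    -- optional prior knowledge on the true system
    (G₁ : Matrix (Fin n₁) (Fin p) ℝ) (G₂ : Matrix (XiIdx m p τ ⊕ Fin m) (Fin n₂) ℝ)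
    (G₃ : Matrix (Fin n₁) (Fin n₂) ℝ)
    (hprior : PriorKnowledge G₁ G₂ G₃ (Matrix.fromCols S.Φ S.Ψ))
    -- the vertices `S.V` span a polytope that contains all consistent system parameters
    (hV : consistentParams (T := T) ud yd S.dset G₁ G₂ G₃ ⊆ convexHull ℝ (Set.range S.V))
    -- stabilizing ingredients
    (hterm : S.TerminalDecrease)
    -- robust control invariant set
    (hroa : S.IsRobustControlInvariant) (hroa0 : (0 : XiIdx m p τ → ℝ) ∈ interior S.roa)
    -- the known disturbance distribution, and a solution of the optimal control problem
    (μ : ProbabilityMeasure (Fin p → ℝ)) (hμ : S.IsDisturbanceLaw μ)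
    (vstar : (XiIdx m p τ → ℝ) → Fin L → Fin m → ℝ) (hvstar : S.IsOptimal μ vstar)
    -- bounds on the optimal cost
    (Pl Pu : Matrix (XiIdx m p τ) (XiIdx m p τ) ℝ) (hPl : Pl.PosSemidef) (hPu : Pu.PosDef)
    (hcost : S.CostBounded μ Pl Pu)
    -- input-output-to-state-stability Lyapunov function
    (PW : Matrix (XiIdx m p τ) (XiIdx m p τ) ℝ) (hPW : PW.PosDef)
    (cu cy cd : ℝ) (hcu : 0 < cu) (hcy : 0 < cy) (hcd : 0 < cd)
    (hIOSS : S.IsIOSSLyapunov PW cu cy cd)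
    -- bound on the probability of infeasibility, and the stability condition
    (εf : ℝ) (hεf : 0 ≤ εf) (hεf1 : εf < 1)
    (hcand : S.CandidateInfeasibleLE μ vstar εf)
    (hQS : ∀ M ∈ S.matPolytope, (S.QS Pl Pu cu cy εf M.toCols₁ M.toCols₂).PosDef) :
    IsRASiE (S.closedLoop vstar) S.roa S.dset
      {ν | S.IsDisturbanceLaw ν ∧ S.CandidateInfeasibleLE ν vstar εf} := by
  obtain ⟨w, hw⟩ := S.exists_isVertexWeights ud yd dd hdd hdata hrank G₁ G₂ G₃ hprior hV
  have h0 := interior_subset hroa0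
  have hopt := hvstar.isNomOptimal hμ hDcompact
  have hval : ∀ ξ ∈ S.roa, wsq Pl ξ ≤ S.value vstar ξ ∧ S.value vstar ξ ≤ wsq Pu ξ :=
    fun ξ hξ => hcost.value_bounds hvstar hμ hDcompact h0 hξ
  -- The condition on the whole matrix polytope is needed only at the true system, which belongs to
  -- it.
  have hQS' : (S.QS Pl Pu cu cy εf S.A S.B).PosDef := by
    simpa using hQS _ hw.fromCols_mem_matPolytope
  obtain ⟨α, a, b, γ, C, ha, hb, hγ, hγ1, hC, hbounds, hdrift⟩ :=
    DPC.exists_lyap_drift hm hp hτ hDcompact hD0 hQ hR hP hw hterm h0 hopt hPl hval hPW hcu hcy hcd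
      hIOSS hεf hεf1 hQS'
  exact DPC.isRASiE_of_lyap_drift hDcompact hroa0
    (fun ξ hξ d hd => DPC.closedLoop_mem_roa hw hopt hξ hd)
    (hopt.measurable_indicator hQ hR hP) ha hb hγ hγ1 hC hbounds hdrift
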